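/- **Izergin--Korepin weights.** For $q,x,y\in\mathbb C$ and $i,j,k,\ell\in\{0,1,2\}$ let $W_{y/x}(i,j;k,\ell)$ be the weight of a vertex with horizontal spectral parameter $x$, vertical spectral parameter $y$, and states $i$ (bottom), $j$ (left), $k$ (top), $\ell$ (right). It vanishes unless $i+j=k+\ell$, and with $D_1=x-q^2y$, $D_2=(x-q^2y)(x-q^3y)$ its other values are $W(0,0;0,0)=W(2,2;2,2)=1$; $W(1,0;1,0)=W(2,1;2,1)=\frac{q^2(x-y)}{D_1}$; $W(1,0;0,1)=W(2,1;1,2)=\frac{(1-q^2)x}{D_1}$; $W(0,1;1,0)=W(1,2;2,1)=\frac{(1-q^2)y}{D_1}$; $W(0,1;0,1)=W(1,2;1,2)=\frac{x-y}{D_1}$; $W(2,0;2,0)=\frac{q^4(x-y)(x-qy)}{D_2}$; $W(2,0;1,1)=-\frac{q(1-q)^2(1+q)x(x-y)}{D_2}$; $W(2,0;0,2)=\frac{(1-q^2)x(x+qx-qy-q^3y)}{D_2}$; $W(1,1;2,0)=-\frac{q^4(1+q)(x-y)y}{D_2}$; $W(1,1;1,1)=\frac{-qx^2+(1+q)(1-q^2+q^4)xy-q^4y^2}{D_2}$;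 $W(1,1;0,2)=\frac{(1+q)x(x-y)}{D_2}$; $W(0,2;2,0)=\frac{(1-q^2)(x+q^2x-q^2y-q^3y)y}{D_2}$; $W(0,2;1,1)=\frac{q(1-q)^2(1+q)(x-y)y}{D_2}$; $W(0,2;0,2)=\frac{(x-y)(x-qy)}{D_2}$. **Stable functions.** A 2-string is a sequence $S=(S_1,S_2,\dots)$ in $\{0,1,2\}$ with finitely many non-zero entries; $\mathfrak s(2)$ is the set of all of them, $|S|=\sum_kS_k$, and $\mathfrak c_a(\cdot)$ counts the entries equal to $a$. We write $(-1)^{n/2}=\mathrm i^{\,n}$ for integers $n\ge 0$. For $I\in\{0,1,2\}^N$ put $|I|=\sum_i I_i$ and $\mathrm{inv}(I)=\sum_{i<j}I_i(2-I_j)$, and let $F^I_S(x_1,\dots,x_N;\boldsymbol z)$ be the partition function (sum over all labellings of the edges by $\{0,1,2\}$ of the product of all vertex weights $W_{z_k/x_i}$) of the lattice with rows $x_1,\dots,x_N$ from bottom to top and columns $z_1,z_2,\dots$ from left to right, whose left boundary states are $I_1,\dots,I_N$ (bottom to top), whose bottom and right boundary states are $0$, and whose top boundary states are $S_1,S_2,\dots$.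 For every $S\in\mathfrak s(2)$ let $$H_S(x_1,\dots,x_N;\boldsymbol z)=\sum_{I\in\{0,1,2\}^N:\ |I|=|S|}(-1)^{\mathfrak c_1(I)/2}(1-q^{-1})^{\mathfrak c_1(I)}q^{-\mathrm{inv}(I)}F^I_S(x_1,\dots,x_N;\boldsymbol z)$$ (so $H_S=0$ if $|S|>2N$), and let $c_S(q)=(-1)^{\mathfrak c_1(S)/2}(1-q)^{-\mathfrak c_1(S)}q^{-\mathfrak c_2(S)}\prod_{k\ge1}q^{2kS_k}$. **Theorem.** Let $N,M\ge1$, let $q,x_i,y_j,z_k\in\mathbb C$ ($1\le i\le N$, $1\le j\le M$, $k\ge1$) with $q\ne0$ and all $z_k\neq0$. Put $$w_1(x,z)=\frac{x-z}{x-q^2z},\quad w_2(x,z)=\frac{(x-z)(x-qz)}{(x-q^2z)(x-q^3z)},\quad v_1(y,z)=\frac{1-q^3yz}{1-qyz},\quad v_2(y,z)=\frac{(1-q^2yz)(1-q^3yz)}{(1-yz)(1-qyz)}.$$ Assume that the $z_k$ stay away from the poles: there is $\delta>0$ with $|(x_i-q^2z_k)(x_i-q^3z_k)|\ge\delta(|x_i|+|z_k|)^2$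 and $|(1-y_jz_k)(1-qy_jz_k)|\ge\delta(1+|y_jz_k|)^2$ for all $i,j,k$. Assume also that there is $\epsilon<1$ such that for all $i,j,k$ $$|v_1(y_j,z_k)\,w_1(x_i,z_k)|<\epsilon,\qquad |v_2(y_j,z_k)\,w_2(x_i,z_k)|<\epsilon,$$ and such that, for all $i\ne i'$, all $j$ and all $k$, respectively all $i$, all $j\neq j'$ and all $k$, $$|v_2(y_j,z_k)\,w_1(x_i,z_k)\,w_1(x_{i'},z_k)|<\epsilon,\qquad |v_1(y_j,z_k)\,v_1(y_{j'},z_k)\,w_2(x_i,z_k)|<\epsilon .$$ Then, with $q^{-3}\boldsymbol z^{-1}=(q^{-3}z_1^{-1},q^{-3}z_2^{-1},\dots)$, the following series converges absolutely and $$\sum_{S\in\mathfrak s(2)}(-1)^{|S|/2}q^{4MN-|S|^2}c_S(q)\,H_S(x_1,\dots,x_N;\boldsymbol z)\,H_S(y_1,\dots,y_M;q^{-3}\boldsymbol z^{-1})=\prod_{i=1}^N\prod_{j=1}^M\frac{(1-q^2x_iy_j)(1-q^3x_iy_j)}{(1-x_iy_j)(1-qx_iy_j)}.$$ -/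

import Mathlib

namespace IzerginKorepin

noncomputable section

/-- An `n`-string: a finitely supported sequence with entries in `{0, …, n}`.
The entry `S k` (with `k = 0, 1, 2, …`) is the component usually written `S_{k+1}`. -/
abbrev NString (n : ℕ) : Type := ℕ →₀ Fin (n + 1)

/-- The weight `|S| = ∑ S_k`. -/
def NString.weight {n : ℕ} (S : NString n) : ℕ := ∑ k ∈ S.support, (S k : ℕ)

/-- The multiplicity of `a` (used for `a ≠ 0`) among the components of `S`. -/
def NString.count {n : ℕ} (a : Fin (n + 1)) (S : NString n) : ℕ :=
  (S.support.filter (fun k => S k = a)).card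

/-- The least `L` such that all components after the first `L` ones vanish. -/
def NString.length {n : ℕ} (S : NString n) : ℕ := S.support.sup (fun k => k + 1)

/-- The Izergin--Korepin vertex weight `W_{y/x}(i, j; k, l)`; `x` is the spectral parameter of the
horizontal line and `y` the one of the vertical line, `i` (bottom) and `j` (left) are the incoming
states, `k` (top) and `l` (right) the outgoing ones. -/
def W (q x y : ℂ) (i j k l : Fin 3) : ℂ :=
  match i, j, k, l with
  | 0, 0, 0, 0 => 1
  | 1, 0, 1, 0 => q ^ 2 * (x - y) / (x - q ^ 2 * y)
  | 1, 0, 0, 1 => (1 - q ^ 2) * x / (x - q ^ 2 * y)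
  | 2, 0, 2, 0 => q ^ 4 * (x - y) * (x - q * y) / ((x - q ^ 2 * y) * (x - q ^ 3 * y))
  | 2, 0, 1, 1 =>
      -(q * (1 - q) ^ 2 * (1 + q) * x * (x - y)) / ((x - q ^ 2 * y) * (x - q ^ 3 * y))
  | 2, 0, 0, 2 =>
      (1 - q ^ 2) * x * (x + q * x - q * y - q ^ 3 * y) / ((x - q ^ 2 * y) * (x - q ^ 3 * y))
  | 0, 1, 1, 0 => (1 - q ^ 2) * y / (x - q ^ 2 * y)
  | 0, 1, 0, 1 => (x - y) / (x - q ^ 2 * y)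
  | 1, 1, 2, 0 => -(q ^ 4 * (1 + q) * (x - y) * y) / ((x - q ^ 2 * y) * (x - q ^ 3 * y))
  | 1, 1, 1, 1 =>
      (-(q * x ^ 2) + (1 + q) * (1 - q ^ 2 + q ^ 4) * x * y - q ^ 4 * y ^ 2) /
        ((x - q ^ 2 * y) * (x - q ^ 3 * y))
  | 1, 1, 0, 2 => (1 + q) * x * (x - y) / ((x - q ^ 2 * y) * (x - q ^ 3 * y))
  | 2, 1, 2, 1 => q ^ 2 * (x - y) / (x - q ^ 2 * y)
  | 2, 1, 1, 2 => (1 - q ^ 2) * x / (x - q ^ 2 * y)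
  | 0, 2, 2, 0 =>
      (1 - q ^ 2) * (x + q ^ 2 * x - q ^ 2 * y - q ^ 3 * y) * y /
        ((x - q ^ 2 * y) * (x - q ^ 3 * y))
  | 0, 2, 1, 1 => q * (1 - q) ^ 2 * (1 + q) * (x - y) * y / ((x - q ^ 2 * y) * (x - q ^ 3 * y))
  | 0, 2, 0, 2 => (x - y) * (x - q * y) / ((x - q ^ 2 * y) * (x - q ^ 3 * y))
  | 1, 2, 2, 1 => (1 - q ^ 2) * y / (x - q ^ 2 * y)
  | 1, 2, 1, 2 => (x - y) / (x - q ^ 2 * y)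
  | 2, 2, 2, 2 => 1
  | _, _, _, _ => 0

/-- The weight of a configuration of the lattice with `N` rows (numbered upwards) and `L` columns
(numbered to the right): `h i c` is the state of the horizontal edge of row `i` to the left of
column `c` (and `h i L` the right outgoing edge), `v r c` is the state of the vertical edge of
column `c` below row `r` (and `v N c` the top outgoing edge). -/
def configWeight (q : ℂ) {N L : ℕ} (x : Fin N → ℂ) (z : ℕ → ℂ)
    (h : Fin N → Fin (L + 1) → Fin 3) (v : Fin (N + 1) → Fin L → Fin 3) : ℂ :=
  ∏ i : Fin N, ∏ c : Fin L,
    W q (x i) (z c) (v i.castSucc c) (h i c.castSucc) (v i.succ c) (h i c.succ)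

/-- The boundary conditions: `J` on the left, `0` at the bottom and on the right, `S` at the top. -/
def IsAdmissible {N L : ℕ} (S : NString 2) (J : Fin N → Fin 3)
    (h : Fin N → Fin (L + 1) → Fin 3) (v : Fin (N + 1) → Fin L → Fin 3) : Prop :=
  (∀ i, h i 0 = J i) ∧ (∀ i, h i (Fin.last L) = 0) ∧
    (∀ c, v 0 c = 0) ∧ (∀ c : Fin L, v (Fin.last N) c = S c)

open Classical in
/-- The partition function `F_S^J(x_1, …, x_N; z)`: the sum of the weights of all configurations
with left boundary `J` and top boundary `S`. All columns beyond the last non-zero component of `S`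
are frozen (all edges in state `0`, all vertices of weight `1`) and are left out. -/
def FLeft (q : ℂ) {N : ℕ} (x : Fin N → ℂ) (z : ℕ → ℂ) (S : NString 2) (J : Fin N → Fin 3) : ℂ :=
  ∑ h : Fin N → Fin (S.length + 1) → Fin 3, ∑ v : Fin (N + 1) → Fin S.length → Fin 3,
    if IsAdmissible S J h v then configWeight q x z h v else 0

/-- The multiplicity of `1` in the vector `J`. -/
def countOnes {N : ℕ} (J : Fin N → Fin 3) : ℕ := (Finset.univ.filter (fun i => J i = 1)).card

/-- `inv(J) = ∑_{i < j} J_i (2 - J_j)`; the subtraction is exact as `J_j ≤ 2`. -/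
def inv {N : ℕ} (J : Fin N → Fin 3) : ℕ :=
  ∑ i : Fin N, ∑ j : Fin N, if i < j then (J i : ℕ) * (2 - (J j : ℕ)) else 0

/-- `(-1)^{n/2}`, where `(-1)^{1/2}` is the imaginary unit. -/
def halfSign (n : ℕ) : ℂ := Complex.I ^ n

/-- The stable function `H_S(x_1, …, x_N; z)`; it is `0` if `|S| > 2N`, the sum being empty. -/
def H (q : ℂ) {N : ℕ} (x : Fin N → ℂ) (z : ℕ → ℂ) (S : NString 2) : ℂ :=
  ∑ J ∈ Finset.univ.filter (fun J : Fin N → Fin 3 => ∑ i, (J i : ℕ) = S.weight),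
    halfSign (countOnes J) * (1 - q⁻¹) ^ countOnes J * (q ^ inv J)⁻¹ * FLeft q x z S J

/-- The coefficient
`c_S(q) = (-1)^{c_1(S)/2} (1 - q)^{-c_1(S)} q^{-c_2(S)} ∏_{k ≥ 1} q^{2 k S_k}`. -/
def cS (q : ℂ) (S : NString 2) : ℂ :=
  halfSign (S.count 1) * ((1 - q) ^ S.count 1)⁻¹ * (q ^ S.count 2)⁻¹ *
    ∏ k ∈ S.support, q ^ (2 * (k + 1) * (S k : ℕ))

end

end IzerginKorepin

/-!
The Cauchy identity is a consequence of the Yang--Baxter equation, followed by a limit in which the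
number of columns of a lattice tends to infinity.

*One lattice.* Multiplied by its denominator, the Izergin--Korepin weight is a quadratic polynomial
`polyW`, which satisfies the Yang--Baxter equation (`polyW_yangBaxter`) and has a crossing symmetry
(`polyW_crossing`): up to a gauge transformation of the vertical edges, a row `y` over the columns
`q⁻³ z⁻¹`, turned upside down, is a row with the weights `polyW q 1 (y * z)`, in which the state
`2` plays the part of the state `0`. Turning the lattice of `H_S(y; q⁻³ z⁻¹)` upside down and
putting it on top of the lattice of `H_S(x; z)` merges the two sums over configurations and the sum
over `S` into the partition function of one lattice. The factors of the summand other than the two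
stable functions are what the gauge transformation and the left boundary of this lattice contribute
(`halfSign_mul_cS_mul_H_mul_H`).

*Exchange of the rows.* The boundary coefficients of `H_S` are the values of ordered products of
operators `creation`, and these satisfy an exchange relation with the matrix of weights `polyW`
(`exchange_creation`). By the Yang--Baxter equation, the relation persists when columns are
attached (`exchange_addColumn`), so that for every number `L` of columns the `x` rows may be moved
through the `y` rows (`exchange_rows`). When the `y` rows are at the bottom and end in the states
`2`, and the `x` rows end in the states `0`, conservation of the states freezes the whole lattice,
and its partition function is an explicit product. With the `x` rows at the bottom one gets a
linear combination of the partition functions with all possible right boundary states, so this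
linear combination does not depend on `L` (`sum_fused_mul_sum_propagate`). The right boundary that
belongs to the series is the vacuum, with the states `0` in the two original lattices; its
coefficient is `∏ (1 - x y) (1 - q x y)`.

*The limit.* Since a column with bottom state `0` can only move states upwards, it acts on the
states of the horizontal edges by a matrix that is triangular with respect to `rank`. The diagonal
entries are products over all rows; pairing a state `1` or `2` of an `x` row with the same state of
a `y` row, or a state `2` with two states `1`, the hypotheses bound them by `ε`, except for the
entry `1` of the vacuum (`prod_mul_prod_le`). So the contribution of every right boundary other
than the vacuum decays geometrically, and the series converges absolutely, to the explicit product
divided by the coefficient of the vacuum (`IsDecaying.hasSum`). This coefficient is not zero,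
because at its zeros one of the diagonal entries would be `1` (`diag_two_eq_one`,
`diag_one_eq_one`).
-/

namespace IzerginKorepin

open Finset

noncomputable section

/-! ### The weights as polynomials and the Yang--Baxter equation -/

/-- The Izergin--Korepin weight `W q x y i j k l` multiplied by `(x - q ^ 2 * y) * (x - q ^ 3 * y)`,
for all states. It is a homogeneous quadratic polynomial in `x` and `y`. -/
def polyW (q x y : ℂ) (i j k l : Fin 3) : ℂ :=
  match i, j, k, l with
  | 0, 0, 0, 0 => (x - q ^ 2 * y) * (x - q ^ 3 * y)
  | 1, 0, 1, 0 => q ^ 2 * (x - y) * (x - q ^ 3 * y)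
  | 1, 0, 0, 1 => (1 - q ^ 2) * x * (x - q ^ 3 * y)
  | 2, 0, 2, 0 => q ^ 4 * (x - y) * (x - q * y)
  | 2, 0, 1, 1 => -(q * (1 - q) ^ 2 * (1 + q) * x * (x - y))
  | 2, 0, 0, 2 => (1 - q ^ 2) * x * (x + q * x - q * y - q ^ 3 * y)
  | 0, 1, 1, 0 => (1 - q ^ 2) * y * (x - q ^ 3 * y)
  | 0, 1, 0, 1 => (x - y) * (x - q ^ 3 * y)
  | 1, 1, 2, 0 => -(q ^ 4 * (1 + q) * (x - y) * y)
  | 1, 1, 1, 1 => -(q * x ^ 2) + (1 + q) * (1 - q ^ 2 + q ^ 4) * x * y - q ^ 4 * y ^ 2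
  | 1, 1, 0, 2 => (1 + q) * x * (x - y)
  | 2, 1, 2, 1 => q ^ 2 * (x - y) * (x - q ^ 3 * y)
  | 2, 1, 1, 2 => (1 - q ^ 2) * x * (x - q ^ 3 * y)
  | 0, 2, 2, 0 => (1 - q ^ 2) * (x + q ^ 2 * x - q ^ 2 * y - q ^ 3 * y) * y
  | 0, 2, 1, 1 => q * (1 - q) ^ 2 * (1 + q) * (x - y) * y
  | 0, 2, 0, 2 => (x - y) * (x - q * y)
  | 1, 2, 2, 1 => (1 - q ^ 2) * y * (x - q ^ 3 * y)
  | 1, 2, 1, 2 => (x - y) * (x - q ^ 3 * y)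
  | 2, 2, 2, 2 => (x - q ^ 2 * y) * (x - q ^ 3 * y)
  | _, _, _, _ => 0

/-- The non-zero values of `polyW`, in a form suitable for rewriting. -/
theorem polyW_values (q x y : ℂ) :
    polyW q x y 0 0 0 0 = (x - q ^ 2 * y) * (x - q ^ 3 * y) ∧
    polyW q x y 1 0 1 0 = q ^ 2 * (x - y) * (x - q ^ 3 * y) ∧
    polyW q x y 1 0 0 1 = (1 - q ^ 2) * x * (x - q ^ 3 * y) ∧
    polyW q x y 2 0 2 0 = q ^ 4 * (x - y) * (x - q * y) ∧
    polyW q x y 2 0 1 1 = -(q * (1 - q) ^ 2 * (1 + q) * x * (x - y)) ∧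
    polyW q x y 2 0 0 2 = (1 - q ^ 2) * x * (x + q * x - q * y - q ^ 3 * y) ∧
    polyW q x y 0 1 1 0 = (1 - q ^ 2) * y * (x - q ^ 3 * y) ∧
    polyW q x y 0 1 0 1 = (x - y) * (x - q ^ 3 * y) ∧
    polyW q x y 1 1 2 0 = -(q ^ 4 * (1 + q) * (x - y) * y) ∧
    polyW q x y 1 1 1 1 = -(q * x ^ 2) + (1 + q) * (1 - q ^ 2 + q ^ 4) * x * y - q ^ 4 * y ^ 2 ∧
    polyW q x y 1 1 0 2 = (1 + q) * x * (x - y) ∧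
    polyW q x y 2 1 2 1 = q ^ 2 * (x - y) * (x - q ^ 3 * y) ∧
    polyW q x y 2 1 1 2 = (1 - q ^ 2) * x * (x - q ^ 3 * y) ∧
    polyW q x y 0 2 2 0 = (1 - q ^ 2) * (x + q ^ 2 * x - q ^ 2 * y - q ^ 3 * y) * y ∧
    polyW q x y 0 2 1 1 = q * (1 - q) ^ 2 * (1 + q) * (x - y) * y ∧
    polyW q x y 0 2 0 2 = (x - y) * (x - q * y) ∧
    polyW q x y 1 2 2 1 = (1 - q ^ 2) * y * (x - q ^ 3 * y) ∧
    polyW q x y 1 2 1 2 = (x - y) * (x - q ^ 3 * y) ∧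
    polyW q x y 2 2 2 2 = (x - q ^ 2 * y) * (x - q ^ 3 * y) := by
  and_intros <;> rfl

theorem polyW_eq_zero (q x y : ℂ) {i j k l : Fin 3} (h : (i + j : ℕ) ≠ k + l) :
    polyW q x y i j k l = 0 := by
  fin_cases i <;> fin_cases j <;> fin_cases k <;> fin_cases l <;>
    first | rfl | exact absurd rfl h

set_option maxHeartbeats 4000000 in
/-- The Yang--Baxter equation for two rows `x` and `y⁻¹` and a column `z`. The incoming states are
`i` (bottom), `a` and `b` (left), the outgoing ones `k` (top), `c` and `d` (right). It is verified
case by case, the states that violate conservation being excluded beforehand. -/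
theorem polyW_yangBaxter (q x y z : ℂ) (i a b k c d : Fin 3) :
    ∑ a' : Fin 3, ∑ b' : Fin 3, ∑ m : Fin 3,
      polyW q x z i a m a' * polyW q 1 (y * z) m b k b' * polyW q 1 (x * y) a' b' d c =
    ∑ a' : Fin 3, ∑ b' : Fin 3, ∑ m : Fin 3,
      polyW q 1 (x * y) a b b' a' * polyW q 1 (y * z) i a' m c * polyW q x z m b' k d := by
  by_cases h : (i + a + b : ℕ) = k + c + d
  · fin_cases i <;> fin_cases a <;> fin_cases b <;> fin_cases k <;> fin_cases c <;> fin_cases d <;>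
    first
    | exact absurd h (by decide)
    | (simp (disch := decide) only [Fin.zero_eta, Fin.mk_one, Fin.reduceFinMk, Fin.sum_univ_three,
         polyW_eq_zero, mul_zero, zero_mul, add_zero, zero_add]
       simp only [polyW_values]
       ring)
  · have hz : ∀ p q' r : ℂ, p = 0 ∨ q' = 0 ∨ r = 0 → p * q' * r = 0 := by
      rintro p q' r (h | h | h) <;> simp [h]
    have h1 : ∀ a' b' m : Fin 3, polyW q x z i a m a' * polyW q 1 (y * z) m b k b' *
        polyW q 1 (x * y) a' b' d c = 0 := by
      intro a' b' m
      apply hz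
      by_contra! hne
      have e1 := not_imp_comm.1 (polyW_eq_zero q x z) hne.1
      have e2 := not_imp_comm.1 (polyW_eq_zero q 1 (y * z)) hne.2.1
      have e3 := not_imp_comm.1 (polyW_eq_zero q 1 (x * y)) hne.2.2
      omega
    have h2 : ∀ a' b' m : Fin 3, polyW q 1 (x * y) a b b' a' * polyW q 1 (y * z) i a' m c *
        polyW q x z m b' k d = 0 := by
      intro a' b' m
      apply hz
      by_contra! hne
      have e1 := not_imp_comm.1 (polyW_eq_zero q 1 (x * y)) hne.1
      have e2 := not_imp_comm.1 (polyW_eq_zero q 1 (y * z)) hne.2.1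
      have e3 := not_imp_comm.1 (polyW_eq_zero q x z) hne.2.2
      omega
    simp only [h1, h2, sum_const_zero]

/-! ### Boundary weights and crossing symmetry -/

theorem W_eq_polyW_div {q x y : ℂ} (h : (x - q ^ 2 * y) * (x - q ^ 3 * y) ≠ 0) (i j k l : Fin 3) :
    W q x y i j k l = polyW q x y i j k l / ((x - q ^ 2 * y) * (x - q ^ 3 * y)) := by
  have h2 := left_ne_zero_of_mul h
  have h3 := right_ne_zero_of_mul h
  fin_cases i <;> fin_cases j <;> fin_cases k <;> fin_cases l <;>
    first
    | exact (zero_div _).symm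
    | exact rfl
    | exact (div_self h).symm
    | exact (mul_div_mul_right _ _ h3).symm

/-- The weight attached to a state by a left boundary edge, apart from powers of `q`. -/
def kappa (q : ℂ) (a : Fin 3) : ℂ := if a = 1 then Complex.I * (1 - q⁻¹) else 1

/-- The boundary vector of two rows, with the components
`kappa q a * kappa q b * q⁻¹ ^ (a * (2 - b))`, is an eigenvector of the matrix that exchanges the
rows. -/
theorem sum_kappa_mul_polyW {q : ℂ} (hq : q ≠ 0) (x y : ℂ) (c d : Fin 3) :
    ∑ a : Fin 3, ∑ b : Fin 3, kappa q a * kappa q b * q⁻¹ ^ ((a : ℕ) * (2 - b)) *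
        polyW q x y a b d c =
      (x - q ^ 2 * y) * (x - q ^ 3 * y) *
        (kappa q c * kappa q d * q⁻¹ ^ ((c : ℕ) * (2 - d))) := by
  have hu : (Complex.I * (1 - q⁻¹)) * (Complex.I * (1 - q⁻¹)) = - (1 - q⁻¹) ^ 2 := by
    linear_combination (1 - q⁻¹) ^ 2 * Complex.I_mul_I
  simp only [kappa]
  generalize Complex.I * (1 - q⁻¹) = u at hu
  fin_cases c <;> fin_cases d <;>
    (simp (disch := decide) only [Fin.zero_eta, Fin.mk_one, Fin.reduceFinMk, Fin.sum_univ_three,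
         polyW_eq_zero, mul_zero, zero_mul, add_zero, zero_add]
     simp only [polyW_values]
     simp [hu]
     try field_simp
     try ring)

/-- The gauge transformation of the vertical edges that relates a row to a row turned upside
down. -/
def gauge (q : ℂ) (a : Fin 3) : ℂ := ![1, -(q ^ 2 / (1 - q)), -q ^ 3] a

/-- Crossing symmetry: turned upside down and gauge transformed, a vertex in row `y` and column
`q⁻³ z⁻¹` is a vertex with the polynomial weight of the parameters `1` and `y * z`, normalized so
that the state `2` on both horizontal edges has weight `1`. -/
theorem polyW_crossing {q : ℂ} (hq : q ≠ 0) (hq1 : q ≠ 1) (y : ℂ) {z : ℂ} (hz : z ≠ 0)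
    (h : (1 - y * z) * (1 - q * y * z) ≠ 0) (i j k l : Fin 3) :
    polyW q 1 (y * z) k j.rev i l.rev / ((1 - y * z) * (1 - q * y * z)) * gauge q i =
      q ^ (2 * (l : ℕ)) * gauge q k * W q y ((q ^ 3)⁻¹ * z⁻¹) i j k l := by
  have hq1' : 1 - q ≠ 0 := sub_ne_zero.2 (Ne.symm hq1)
  have h1 := left_ne_zero_of_mul h
  have h2 := right_ne_zero_of_mul h
  have hp : (y - q ^ 2 * ((q ^ 3)⁻¹ * z⁻¹)) * (y - q ^ 3 * ((q ^ 3)⁻¹ * z⁻¹)) =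
      (1 - y * z) * (1 - q * y * z) * (q⁻¹ * (z⁻¹) ^ 2) := by
    field_simp
    ring
  have hp' : (y - q ^ 2 * ((q ^ 3)⁻¹ * z⁻¹)) * (y - q ^ 3 * ((q ^ 3)⁻¹ * z⁻¹)) ≠ 0 := by
    rw [hp]
    positivity
  rw [W_eq_polyW_div hp', hp]
  by_cases hc : (i + j : ℕ) = k + l
  · fin_cases i <;> fin_cases j <;> fin_cases k <;> fin_cases l <;>
    first
    | exact absurd hc (by decide)
    | (simp only [Fin.zero_eta, Fin.mk_one, Fin.reduceFinMk, show Fin.rev (0 : Fin 3) = 2 from rfl,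
        show Fin.rev (1 : Fin 3) = 1 from rfl, show Fin.rev (2 : Fin 3) = 0 from rfl, polyW_values]
       simp [gauge]
       field_simp
       try ring)
  · rw [polyW_eq_zero _ _ _ hc, polyW_eq_zero _ _ _ (by simp [Fin.val_rev]; omega)]
    simp

/-! ### The exchange relation for several rows -/

/-- A table of vertex weights `w i j k l`, with the states `i` (bottom), `j` (left), `k` (top) and
`l` (right). -/
abbrev Weights : Type := Fin 3 → Fin 3 → Fin 3 → Fin 3 → ℂ

/-- The sum of the incoming states equals the sum of the outgoing states at every vertex of non-zero
weight. -/
def Weights.Conserving (w : Weights) : Prop :=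
  ∀ ⦃i j k l : Fin 3⦄, w i j k l ≠ 0 → (i + j : ℕ) = k + l

theorem sum_cons {n : ℕ} {β : Type*} [AddCommMonoid β] (f : (Fin (n + 1) → Fin 3) → β) :
    ∑ A, f A = ∑ a, ∑ A : Fin n → Fin 3, f (Fin.cons a A) := by
  rw [← (Fin.consEquiv (fun _ : Fin (n + 1) => Fin 3)).sum_comp, Fintype.sum_prod_type]
  rfl

/-- The sum `|A|` of the states of all rows. -/
def total {n : ℕ} (A : Fin n → Fin 3) : ℕ := ∑ i, (A i : ℕ)

theorem total_succ {n : ℕ} (A : Fin (n + 1) → Fin 3) :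
    total A = A 0 + total (Fin.tail A) := by
  simp [total, Fin.sum_univ_succ, Fin.tail]

/-- The product `X 0 (A 0) * X 1 (A 1) * ⋯` of elements of a monoid, one for each row from bottom to
top, that are chosen by the states `A` of the rows. -/
def orderedProd {n : ℕ} {𝓐 : Type*} [Monoid 𝓐] (X : Fin n → Fin 3 → 𝓐) (A : Fin n → Fin 3) : 𝓐 :=
  (List.ofFn fun i => X i (A i)).prod

theorem orderedProd_zero {𝓐 : Type*} [Monoid 𝓐] (X : Fin 0 → Fin 3 → 𝓐) (A : Fin 0 → Fin 3) :
    orderedProd X A = 1 := by simp [orderedProd]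

theorem orderedProd_succ {n : ℕ} {𝓐 : Type*} [Monoid 𝓐] (X : Fin (n + 1) → Fin 3 → 𝓐)
    (A : Fin (n + 1) → Fin 3) :
    orderedProd X A = X 0 (A 0) * orderedProd (Fin.tail X) (Fin.tail A) := by
  simp [orderedProd, List.ofFn_succ, Fin.tail]

/-- The exchange relation of Zamolodchikov--Faddeev type: the families `X` and `Y`, indexed by the
state of a row, may be commuted at the cost of the matrix of vertex weights `R`. -/
def Exchange {𝓐 : Type*} [Ring 𝓐] [Algebra ℂ 𝓐] (R : Weights) (κ : ℂ) (X Y : Fin 3 → 𝓐) : Prop :=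
  ∀ c d, ∑ a, ∑ b, R a b d c • (X a * Y b) = κ • (Y c * X d)

/-- The partition function of one row crossing `n` others: the coefficient of `X_A * Y_b` in the
expansion of a multiple of `Y_c * X_D` obtained by moving `Y` through the product `X_D`. -/
def fusedRow : {n : ℕ} → (Fin n → Weights) → Fin 3 → (Fin n → Fin 3) → (Fin n → Fin 3) → Fin 3 → ℂ
  | 0, _, c, _, _, b => if b = c then 1 else 0
  | _ + 1, R, c, D, A, b =>
      ∑ e, R 0 (A 0) e (D 0) c * fusedRow (Fin.tail R) e (Fin.tail D) (Fin.tail A) b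

/-- The partition function of `m` rows crossing `n` others: the coefficient of `X_A * Y_B` in the
expansion of a multiple of `Y_C * X_D` obtained by moving all `Y` through all `X`. -/
def fused {n : ℕ} : {m : ℕ} → (Fin m → Fin n → Weights) → (Fin m → Fin 3) → (Fin n → Fin 3) →
    (Fin n → Fin 3) → (Fin m → Fin 3) → ℂ
  | 0, _, _, D, A, _ => if A = D then 1 else 0
  | _ + 1, R, C, D, A, B =>
      ∑ A', fused (Fin.tail R) (Fin.tail C) D A' (Fin.tail B) * fusedRow (R 0) (C 0) A' A (B 0)

theorem total_of_fusedRow_ne_zero {n : ℕ} {R : Fin n → Weights} (hR : ∀ i, (R i).Conserving)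
    {c : Fin 3} {D A : Fin n → Fin 3} {b : Fin 3} (h : fusedRow R c D A b ≠ 0) :
    total A + b = c + total D := by
  induction n generalizing c with
  | zero =>
    rw [fusedRow] at h
    have : b = c := by by_contra hne; simp [hne] at h
    simp [total, this]
  | succ n ih =>
    rw [fusedRow] at h
    obtain ⟨e, -, he⟩ := exists_ne_zero_of_sum_ne_zero h
    have h1 := hR 0 (left_ne_zero_of_mul he)
    have h2 := ih (R := Fin.tail R) (fun i => hR i.succ) (right_ne_zero_of_mul he)
    rw [total_succ, total_succ D]
    omega

theorem fusedRow_zero {n : ℕ} {R : Fin n → Weights} (hR : ∀ i, (R i).Conserving) (c : Fin 3) :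
    fusedRow R c 0 0 c = ∏ i, R i 0 c 0 c := by
  induction n with
  | zero => simp [fusedRow]
  | succ n ih =>
    rw [fusedRow, Finset.sum_eq_single c, Fin.prod_univ_succ]
    · have := ih (R := Fin.tail R) (fun i => hR i.succ)
      exact congrArg _ this
    · intro e _ hec
      by_contra hne
      have := hR 0 (left_ne_zero_of_mul hne)
      apply hec
      ext
      simpa using this
    · simp

theorem total_of_fused_ne_zero {n m : ℕ} {R : Fin m → Fin n → Weights}
    (hR : ∀ j i, (R j i).Conserving) {C : Fin m → Fin 3} {D A : Fin n → Fin 3} {B : Fin m → Fin 3}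
    (h : fused R C D A B ≠ 0) : total A + total B = total C + total D := by
  induction m generalizing A with
  | zero =>
    rw [fused] at h
    have : A = D := by by_contra hne; simp [hne] at h
    simp [total, this]
  | succ m ih =>
    rw [fused] at h
    obtain ⟨e, -, he⟩ := exists_ne_zero_of_sum_ne_zero h
    have h1 := ih (R := Fin.tail R) (fun i => hR i.succ) (left_ne_zero_of_mul he)
    have h2 := total_of_fusedRow_ne_zero (hR 0) (right_ne_zero_of_mul he)
    rw [total_succ, total_succ C]
    omega

theorem eq_zero_of_total_eq_zero {n : ℕ} {A : Fin n → Fin 3} (h : total A = 0) : A = 0 := by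
  funext i
  rw [total, Finset.sum_eq_zero_iff] at h
  ext
  exact h i (mem_univ i)

/-- When the `m` rows are in the state `2` and the `n` rows in the state `0` on all sides,
conservation leaves a single configuration. -/
theorem fused_zero {n m : ℕ} {R : Fin m → Fin n → Weights} (hR : ∀ j i, (R j i).Conserving) :
    fused R (fun _ => 2) 0 0 (fun _ => 2) = ∏ j, ∏ i, R j i 0 2 0 2 := by
  induction m with
  | zero => simp [fused]
  | succ m ih =>
    rw [fused, Finset.sum_eq_single 0, Fin.prod_univ_succ, mul_comm]
    · have := ih (R := Fin.tail R) (fun i => hR i.succ)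
      rw [fusedRow_zero (hR 0)]
      exact congrArg _ this
    · intro e _ hec
      by_contra hne
      have := total_of_fusedRow_ne_zero (hR 0) (right_ne_zero_of_mul hne)
      apply hec
      apply eq_zero_of_total_eq_zero
      have h0 : total (0 : Fin n → Fin 3) = 0 := by simp [total]
      omega
    · simp

section
variable {𝓐 : Type*} [Ring 𝓐] [Algebra ℂ 𝓐]

theorem exchange_row {n : ℕ} {R : Fin n → Weights} {κ : Fin n → ℂ} {X : Fin n → Fin 3 → 𝓐}
    {Y : Fin 3 → 𝓐} (h : ∀ i, Exchange (R i) (κ i) (X i) Y) (c : Fin 3) (D : Fin n → Fin 3) :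
    (∏ i, κ i) • (Y c * orderedProd X D) =
      ∑ A, ∑ b, fusedRow R c D A b • (orderedProd X A * Y b) := by
  induction n generalizing c with
  | zero => simp [orderedProd_zero, fusedRow]
  | succ n ih =>
    have key := fun e D =>
      ih (R := Fin.tail R) (κ := Fin.tail κ) (X := Fin.tail X) (fun i => h i.succ) e D
    calc (∏ i, κ i) • (Y c * orderedProd X D)
        = ∑ a, ∑ e, R 0 a e (D 0) c • (X 0 a *
            ((∏ i : Fin n, κ i.succ) • (Y e * orderedProd (Fin.tail X) (Fin.tail D)))) := by
          rw [orderedProd_succ, ← mul_assoc, Fin.prod_univ_succ, mul_comm (κ 0), mul_smul,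
            ← smul_mul_assoc, ← h 0]
          simp only [sum_mul, smul_sum, smul_mul_assoc, mul_smul_comm, mul_assoc]
          exact sum_congr rfl fun a _ => sum_congr rfl fun e _ => smul_comm _ _ _
      _ = ∑ a, ∑ A, ∑ b, ∑ e, R 0 a e (D 0) c • fusedRow (Fin.tail R) e (Fin.tail D) A b •
            (X 0 a * orderedProd (Fin.tail X) A * Y b) := by
          refine sum_congr rfl fun a _ => ?_
          have hk : ∀ e,
              (∏ i : Fin n, κ i.succ) • (Y e * orderedProd (Fin.tail X) (Fin.tail D)) = _ :=
            fun e => key e (Fin.tail D)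
          simp only [hk, mul_sum, smul_sum, mul_smul_comm, mul_assoc]
          rw [sum_comm]
          exact sum_congr rfl fun A _ => sum_comm
      _ = _ := by
          rw [sum_cons]
          simp only [fusedRow, sum_smul, mul_smul, orderedProd_succ, Fin.cons_zero, Fin.tail_cons]

theorem exchange_rows {n m : ℕ} {R : Fin m → Fin n → Weights} {κ : Fin m → Fin n → ℂ}
    {X : Fin n → Fin 3 → 𝓐} {Y : Fin m → Fin 3 → 𝓐}
    (h : ∀ j i, Exchange (R j i) (κ j i) (X i) (Y j)) (C : Fin m → Fin 3) (D : Fin n → Fin 3) :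
    (∏ j, ∏ i, κ j i) • (orderedProd Y C * orderedProd X D) =
      ∑ A, ∑ B, fused R C D A B • (orderedProd X A * orderedProd Y B) := by
  induction m generalizing D with
  | zero => simp [orderedProd_zero, fused]
  | succ m ih =>
    have key := fun C D =>
      ih (R := Fin.tail R) (κ := Fin.tail κ) (Y := Fin.tail Y) (fun j => h j.succ) C D
    calc (∏ j, ∏ i, κ j i) • (orderedProd Y C * orderedProd X D)
        = (∏ i, κ 0 i) • (Y 0 (C 0) *
            ((∏ j : Fin m, ∏ i, κ j.succ i) •
              (orderedProd (Fin.tail Y) (Fin.tail C) * orderedProd X D))) := by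
          rw [orderedProd_succ, Fin.prod_univ_succ, mul_smul, mul_smul_comm, mul_assoc]
      _ = ∑ A', ∑ B, fused (Fin.tail R) (Fin.tail C) D A' B •
            (((∏ i, κ 0 i) • (Y 0 (C 0) * orderedProd X A')) * orderedProd (Fin.tail Y) B) := by
          have hk : (∏ j : Fin m, ∏ i, κ j.succ i) •
              (orderedProd (Fin.tail Y) (Fin.tail C) * orderedProd X D) = _ := key (Fin.tail C) D
          simp only [hk, mul_sum, smul_sum, mul_smul_comm, smul_mul_assoc, mul_assoc]
          exact sum_congr rfl fun a _ => sum_congr rfl fun e _ => smul_comm _ _ _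
      _ = ∑ A', ∑ B, ∑ A, ∑ b, fused (Fin.tail R) (Fin.tail C) D A' B •
            fusedRow (R 0) (C 0) A' A b •
            (orderedProd X A * (Y 0 b * orderedProd (Fin.tail Y) B)) := by
          simp only [exchange_row (h 0), sum_mul, smul_sum, smul_mul_assoc, mul_assoc]
      _ = ∑ A, ∑ b, ∑ B, ∑ A', fused (Fin.tail R) (Fin.tail C) D A' B •
            fusedRow (R 0) (C 0) A' A b •
            (orderedProd X A * (Y 0 b * orderedProd (Fin.tail Y) B)) := by
          rw [sum_comm]
          calc _ = ∑ B, ∑ A, ∑ b, ∑ A', fused (Fin.tail R) (Fin.tail C) D A' B •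
                fusedRow (R 0) (C 0) A' A b •
                (orderedProd X A * (Y 0 b * orderedProd (Fin.tail Y) B)) := by
                refine sum_congr rfl fun B _ => ?_
                rw [sum_comm]
                exact sum_congr rfl fun A _ => sum_comm
            _ = _ := by
                rw [sum_comm]
                exact sum_congr rfl fun A _ => sum_comm
      _ = _ := by
          refine sum_congr rfl fun A _ => ?_
          rw [sum_cons]
          simp only [fused, sum_smul, mul_smul, orderedProd_succ, Fin.cons_zero, Fin.tail_cons]
end

/-! ### Columns -/

/-- The Yang--Baxter equation for a column that crosses two rows with the weights `w` and `v`, which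
cross each other with the weights `R`. -/
def YangBaxter (w v R : Weights) : Prop :=
  ∀ i a b k c d,
    ∑ a', ∑ b', ∑ m, w i a m a' * v m b k b' * R a' b' d c =
      ∑ a', ∑ b', ∑ m, R a b b' a' * v i a' m c * w m b' k d

/-- The vertex weights as a matrix acting on the vertical edge, for given states of the horizontal
edges. -/
def vertexMatrix (w : Weights) (j l : Fin 3) : Matrix (Fin 3) (Fin 3) ℂ :=
  Matrix.of fun i k => w i j k l

/-- The partition function of a single column as a matrix in the states of its bottom and top edges,
where `I` are the states on its left and `A` those on its right. The rows are numbered from bottom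
to top. -/
def columnMatrix {n : ℕ} (w : Fin n → Weights) (I A : Fin n → Fin 3) : Matrix (Fin 3) (Fin 3) ℂ :=
  (List.ofFn fun i => vertexMatrix (w i) (I i) (A i)).prod

theorem columnMatrix_succ {n : ℕ} (w : Fin (n + 1) → Weights) (I A : Fin (n + 1) → Fin 3) :
    columnMatrix w I A =
      vertexMatrix (w 0) (I 0) (A 0) * columnMatrix (Fin.tail w) (Fin.tail I) (Fin.tail A) := by
  simp [columnMatrix, List.ofFn_succ, Fin.tail]

theorem columnMatrix_succ_apply {n : ℕ} (w : Fin (n + 1) → Weights) (I A : Fin (n + 1) → Fin 3)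
    (b t : Fin 3) :
    columnMatrix w I A b t = ∑ s, w 0 b (I 0) s (A 0) *
      columnMatrix (Fin.tail w) (Fin.tail I) (Fin.tail A) s t := by
  rw [columnMatrix_succ, Matrix.mul_apply]
  rfl

theorem total_of_columnMatrix_ne_zero {n : ℕ} {w : Fin n → Weights}
    (hw : ∀ i, (w i).Conserving) {I A : Fin n → Fin 3} {b t : Fin 3}
    (h : columnMatrix w I A b t ≠ 0) : b + total I = t + total A := by
  induction n generalizing b with
  | zero =>
    have : b = t := by
      by_contra hne
      simp [columnMatrix, hne] at h
    simp [total, this]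
  | succ n ih =>
    rw [columnMatrix_succ_apply] at h
    obtain ⟨s, -, hs⟩ := exists_ne_zero_of_sum_ne_zero h
    have h1 := hw 0 (left_ne_zero_of_mul hs)
    have h2 := ih (w := Fin.tail w) (fun i => hw i.succ) (right_ne_zero_of_mul hs)
    rw [total_succ, total_succ A]
    omega

/-- A weighted sum of the states of the rows, in which a lower row counts more. It decreases when
states move upwards. -/
def rank {n : ℕ} (I : Fin n → Fin 3) : ℕ := ∑ i : Fin n, (n - (i : ℕ)) * (I i : ℕ)

theorem rank_succ {n : ℕ} (I : Fin (n + 1) → Fin 3) :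
    rank I = (n + 1) * (I 0 : ℕ) + rank (Fin.tail I) := by
  simp [rank, Fin.sum_univ_succ, Fin.tail]

theorem rank_le_of_columnMatrix_ne_zero {n : ℕ} {w : Fin n → Weights}
    (hw : ∀ i, (w i).Conserving) {I A : Fin n → Fin 3} {b t : Fin 3}
    (h : columnMatrix w I A b t ≠ 0) : rank A ≤ rank I + n * b := by
  induction n generalizing b with
  | zero => simp [rank]
  | succ n ih =>
    rw [columnMatrix_succ_apply] at h
    obtain ⟨s, -, hs⟩ := exists_ne_zero_of_sum_ne_zero h
    have h1 := hw 0 (left_ne_zero_of_mul hs)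
    have h2 := ih (w := Fin.tail w) (fun i => hw i.succ) (right_ne_zero_of_mul hs)
    rw [rank_succ A, rank_succ I]
    nlinarith

/-- A column with bottom state `0` is triangular with respect to `rank`: it leaves all states as
they are, or moves some of them upwards. -/
theorem rank_lt_of_columnMatrix_ne_zero {n : ℕ} {w : Fin n → Weights}
    (hw : ∀ i, (w i).Conserving) {I A : Fin n → Fin 3} {t : Fin 3}
    (h : columnMatrix w I A 0 t ≠ 0) : (A = I ∧ t = 0) ∨ rank A < rank I := by
  induction n with
  | zero =>
    refine .inl ⟨Subsingleton.elim _ _, ?_⟩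
    by_contra hne
    simp [columnMatrix, Ne.symm hne] at h
  | succ n ih =>
    rw [columnMatrix_succ_apply] at h
    obtain ⟨s, -, hs⟩ := exists_ne_zero_of_sum_ne_zero h
    have h1 := hw 0 (left_ne_zero_of_mul hs)
    have h2 := right_ne_zero_of_mul hs
    rw [rank_succ A, rank_succ I]
    by_cases h0 : s = 0
    · subst h0
      have h3 : A 0 = I 0 := by ext; simpa using h1.symm
      rcases ih (w := Fin.tail w) (fun i => hw i.succ) h2 with ⟨h4, h5⟩ | h4
      · refine .inl ⟨?_, h5⟩
        rw [← Fin.cons_self_tail A, ← Fin.cons_self_tail I, h3, h4]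
      · right
        rw [h3]
        omega
    · right
      have h3 := rank_le_of_columnMatrix_ne_zero (w := Fin.tail w) (fun i => hw i.succ) h2
      have h4 : 0 < (s : ℕ) := Nat.pos_of_ne_zero fun h => h0 (Fin.ext h)
      simp only [Fin.val_zero, zero_add] at h1
      nlinarith

theorem columnMatrix_self {n : ℕ} {w : Fin n → Weights}
    (hw : ∀ i, (w i).Conserving) (I : Fin n → Fin 3) :
    columnMatrix w I I 0 0 = ∏ i, w i 0 (I i) 0 (I i) := by
  induction n with
  | zero => simp [columnMatrix]
  | succ n ih =>
    rw [columnMatrix_succ_apply, Finset.sum_eq_single 0, Fin.prod_univ_succ]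
    · exact congrArg _ (ih (w := Fin.tail w) (fun i => hw i.succ) _)
    · intro s _ hs
      by_contra hne
      have := hw 0 (left_ne_zero_of_mul hne)
      apply hs
      ext
      simpa using this
    · simp

theorem sum_rotate₃ {α β γ M : Type*} [Fintype α] [Fintype β] [Fintype γ]
    [AddCommMonoid M] (F : α → β → γ → M) :
    ∑ x, ∑ y, ∑ a, F x y a = ∑ a, ∑ x, ∑ y, F x y a :=
  (sum_congr rfl fun _ _ => sum_comm).trans sum_comm

theorem sum_rotate₄ {α β γ δ M : Type*} [Fintype α] [Fintype β] [Fintype γ] [Fintype δ]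
    [AddCommMonoid M] (F : α → β → γ → δ → M) :
    ∑ x, ∑ y, ∑ u, ∑ a, F x y u a = ∑ a, ∑ x, ∑ y, ∑ u, F x y u a :=
  (sum_congr rfl fun _ _ => sum_rotate₃ _).trans sum_comm

section
variable {𝓐 : Type*} [Ring 𝓐] [Algebra ℂ 𝓐]

/-- The family of matrices over `𝓐` that arises when a vertex with the weights `w` is attached on
the right of a row described by the family `X`. The index of the family is the state of the right
edge, the indices of the matrix are the states of the vertical edges. -/
def addColumn (w : Weights) (X : Fin 3 → 𝓐) (a : Fin 3) : Matrix (Fin 3) (Fin 3) 𝓐 :=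
  Matrix.of fun s t => ∑ j, w s j t a • X j

theorem orderedProd_addColumn {n : ℕ} (w : Fin n → Weights) (X : Fin n → Fin 3 → 𝓐)
    (A : Fin n → Fin 3) (s t : Fin 3) :
    orderedProd (fun i => addColumn (w i) (X i)) A s t =
      ∑ I, columnMatrix w I A s t • orderedProd X I := by
  induction n generalizing s with
  | zero =>
    simp [orderedProd_zero, columnMatrix, Matrix.one_apply]
  | succ n ih =>
    rw [orderedProd_succ, Matrix.mul_apply, sum_cons]
    have key := fun s => ih (Fin.tail w) (Fin.tail X) (Fin.tail A) s
    simp only [columnMatrix_succ_apply, orderedProd_succ, Fin.cons_zero, Fin.tail_cons]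
    change ∑ r, addColumn (w 0) (X 0) (A 0) s r *
      orderedProd (fun i : Fin n => addColumn (Fin.tail w i) (Fin.tail X i)) (Fin.tail A) r t = _
    simp only [key, addColumn, Matrix.of_apply, sum_mul, mul_sum, smul_mul_assoc, mul_smul_comm,
      sum_smul, mul_smul]
    rw [sum_comm]
    simp only [smul_sum]
    refine (sum_rotate₃ _).trans ?_
    exact sum_congr rfl fun j _ => sum_congr rfl fun I _ => sum_congr rfl fun r _ => smul_comm _ _ _

/-- By the Yang--Baxter equation, attaching a column preserves the exchange relation. -/
theorem exchange_addColumn {w v R : Weights} (h : YangBaxter w v R) {κ : ℂ} {X Y : Fin 3 → 𝓐}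
    (hXY : Exchange R κ X Y) : Exchange R κ (addColumn w X) (addColumn v Y) := by
  intro c d
  ext i k
  simp only [Matrix.sum_apply, Matrix.smul_apply, Matrix.mul_apply, addColumn, Matrix.of_apply]
  calc ∑ a', ∑ b', R a' b' d c • ∑ m, (∑ a, w i a m a' • X a) * ∑ b, v m b k b' • Y b
      = ∑ a, ∑ b, (∑ a', ∑ b', ∑ m, w i a m a' * v m b k b' * R a' b' d c) • (X a * Y b) := by
        simp only [sum_mul, mul_sum, smul_sum, sum_smul, smul_mul_assoc, mul_smul_comm, mul_smul]
        refine (sum_congr rfl fun _ _ => sum_rotate₄ _).trans (sum_comm.trans ?_)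
        refine sum_congr rfl fun a _ => (sum_rotate₄ _).trans ?_
        refine sum_congr rfl fun b _ => sum_congr rfl fun a' _ => sum_congr rfl fun b' _ =>
          sum_congr rfl fun m _ => ?_
        simp only [smul_smul]
        congr 1
        ring
    _ = ∑ a, ∑ b, (∑ a', ∑ b', ∑ m, R a b b' a' * v i a' m c * w m b' k d) • (X a * Y b) := by
        simp only [h i _ _ k c d]
    _ = ∑ m, ∑ d', ∑ c', (v i c' m c * w m d' k d) • ∑ a, ∑ b, R a b d' c' • (X a * Y b) := by
        simp only [smul_sum, sum_smul, mul_smul]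
        refine (sum_congr rfl fun _ _ => sum_rotate₄ _).trans (sum_comm.trans ?_)
        refine sum_congr rfl fun m _ => (sum_rotate₄ _).trans ?_
        refine sum_congr rfl fun d' _ => (sum_rotate₃ _).trans ?_
        refine sum_congr rfl fun c' _ => sum_congr rfl fun a _ => sum_congr rfl fun b _ => ?_
        simp only [smul_smul]
        congr 1
        ring
    _ = _ := by
        simp only [hXY _ _, smul_sum, sum_mul, mul_sum, smul_mul_assoc, mul_smul_comm, mul_smul]
        refine sum_congr rfl fun m _ => sum_congr rfl fun d' _ => sum_congr rfl fun c' _ => ?_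
        simp only [smul_smul]
        congr 1
        ring
end

/-! ### The left boundary and the exchange of all rows -/

/-- The operator of the left boundary edge of a row in the state `a`. The argument of the functions
it acts on is the sum of the states of the rows below, so that ordered products of these operators
produce the factor `q ^ (-inv)` of the stable functions. -/
def creation (q : ℂ) (a : Fin 3) : Module.End ℂ (ℕ → ℂ) where
  toFun f m := kappa q a * q⁻¹ ^ (m * (2 - (a : ℕ))) * f (m + a)
  map_add' f g := by ext m; simp [mul_add]
  map_smul' c f := by ext m; simp only [Pi.smul_apply, smul_eq_mul, RingHom.id_apply]; ring

theorem creation_apply (q : ℂ) (a : Fin 3) (f : ℕ → ℂ) (m : ℕ) :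
    creation q a f m = kappa q a * q⁻¹ ^ (m * (2 - (a : ℕ))) * f (m + a) := rfl

theorem conserving_polyW (q x y : ℂ) : Weights.Conserving (polyW q x y) := by
  intro i j k l h
  by_contra hne
  exact h (polyW_eq_zero q x y hne)

theorem exchange_creation {q : ℂ} (hq : q ≠ 0) (x y : ℂ) :
    Exchange (polyW q x y) ((x - q ^ 2 * y) * (x - q ^ 3 * y)) (creation q) (creation q) := by
  intro c d
  have two_le : ∀ a : Fin 3, (a : ℕ) ≤ 2 := fun a => by omega
  ext f m
  simp only [LinearMap.sum_apply, LinearMap.smul_apply, Module.End.mul_apply, Finset.sum_apply,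
    Pi.smul_apply, smul_eq_mul, creation_apply]
  have key : ∀ a b : Fin 3, (a + b : ℕ) = c + d →
      kappa q a * q⁻¹ ^ (m * (2 - (a : ℕ))) *
        (kappa q b * q⁻¹ ^ ((m + a) * (2 - (b : ℕ))) * f (m + a + b)) =
      kappa q a * kappa q b * q⁻¹ ^ ((a : ℕ) * (2 - b)) *
        (q⁻¹ ^ (m * (4 - (c + d))) * f (m + (c + d))) := by
    intro a b hab
    have e : m * (4 - (c + d : ℕ)) = m * (2 - (a : ℕ)) + m * (2 - (b : ℕ)) := by
      rw [← mul_add]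
      congr 1
      have := two_le a
      have := two_le b
      omega
    rw [add_assoc, hab, e, add_mul, pow_add, pow_add]
    ring
  rw [key c d rfl, ← mul_assoc, ← sum_kappa_mul_polyW hq, sum_mul]
  refine sum_congr rfl fun a _ => ?_
  rw [sum_mul]
  refine sum_congr rfl fun b _ => ?_
  by_cases hab : (a + b : ℕ) = c + d
  · rw [key a b hab]
    ring
  · rw [polyW_eq_zero _ _ _ (by omega)]
    ring

/-- The sum of the complementary states `2 - A i`. -/
def cototal {n : ℕ} (A : Fin n → Fin 3) : ℕ := ∑ i, (2 - (A i : ℕ))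

theorem cototal_succ {n : ℕ} (A : Fin (n + 1) → Fin 3) :
    cototal A = (2 - (A 0 : ℕ)) + cototal (Fin.tail A) := by
  simp [cototal, Fin.sum_univ_succ, Fin.tail]

theorem inv_succ {n : ℕ} (A : Fin (n + 1) → Fin 3) :
    inv A = A 0 * cototal (Fin.tail A) + inv (Fin.tail A) := by
  simp [inv, cototal, Fin.sum_univ_succ, Fin.tail, Finset.mul_sum]

theorem orderedProd_creation_apply (q : ℂ) {n : ℕ} (A : Fin n → Fin 3) (f : ℕ → ℂ) (m : ℕ) :
    orderedProd (fun _ => creation q) A f m =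
      (∏ i, kappa q (A i)) * q⁻¹ ^ (inv A + m * cototal A) * f (m + total A) := by
  induction n generalizing m with
  | zero => simp [orderedProd_zero, inv, cototal, total]
  | succ n ih =>
    have := ih (Fin.tail A) (m + A 0)
    rw [orderedProd_succ, Module.End.mul_apply, creation_apply]
    change _ * (orderedProd (fun _ => creation q) (Fin.tail A) f _) = _
    rw [this, inv_succ, cototal_succ, total_succ, Fin.prod_univ_succ, ← add_assoc]
    simp only [Fin.tail]
    ring

/-- The value at `0` of the image of the constant function `1`. -/
def vacuumValue : Module.End ℂ (ℕ → ℂ) →ₗ[ℂ] ℂ where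
  toFun T := T 1 0
  map_add' _ _ := rfl
  map_smul' _ _ := rfl

theorem vacuumValue_creation (q : ℂ) {n m : ℕ} (A : Fin n → Fin 3) (B : Fin m → Fin 3) :
    vacuumValue (orderedProd (fun _ => creation q) A * orderedProd (fun _ => creation q) B) =
      (∏ i, kappa q (A i)) * (∏ i, kappa q (B i)) *
        q⁻¹ ^ (inv A + inv B + total A * cototal B) := by
  change orderedProd (fun _ => creation q) A (orderedProd (fun _ => creation q) B 1) 0 = _
  rw [orderedProd_creation_apply, orderedProd_creation_apply]
  simp only [Pi.one_apply]
  ring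

/-- The partition function of the lattice with `L` columns, the lower rows having the weights `u`
and the upper rows the weights `v`, as a function of the states on the right. Here `ψ` is the left
boundary vector, and the bottom and top edges are in the state `0`. -/
def transfer {n m : ℕ} (u : ℕ → Fin n → Weights) (v : ℕ → Fin m → Weights)
    (ψ : (Fin n → Fin 3) → (Fin m → Fin 3) → ℂ) :
    ℕ → (Fin n → Fin 3) → (Fin m → Fin 3) → ℂ
  | 0 => ψ
  | L + 1 => fun A B =>
      ∑ I, ∑ J, (columnMatrix (u L) I A * columnMatrix (v L) J B) 0 0 * transfer u v ψ L I J

/-- The functional `ℓ` applied to the entry of a matrix with the vertical edges in the state `0`. -/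
def entryFunctional {𝓐 : Type*} [Ring 𝓐] [Algebra ℂ 𝓐] (ℓ : 𝓐 →ₗ[ℂ] ℂ) :
    Matrix (Fin 3) (Fin 3) 𝓐 →ₗ[ℂ] ℂ where
  toFun T := ℓ (T 0 0)
  map_add' _ _ := by simp
  map_smul' _ _ := by simp

theorem entryFunctional_apply {𝓐 : Type*} [Ring 𝓐] [Algebra ℂ 𝓐] (ℓ : 𝓐 →ₗ[ℂ] ℂ)
    (T : Matrix (Fin 3) (Fin 3) 𝓐) : entryFunctional ℓ T = ℓ (T 0 0) := rfl

theorem total_two (m : ℕ) : total (fun _ : Fin m => (2 : Fin 3)) = 2 * m := by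
  simp [total, mul_comm]

theorem total_le {m : ℕ} (A : Fin m → Fin 3) : total A ≤ 2 * m := by
  rw [← total_two]
  exact sum_le_sum fun i _ => Fin.le_last (A i)

theorem eq_two_of_total {m : ℕ} {A : Fin m → Fin 3} (h : 2 * m ≤ total A) : A = fun _ => 2 := by
  by_contra hne
  obtain ⟨i, hi⟩ := Function.ne_iff.1 hne
  have : total A < total (fun _ : Fin m => (2 : Fin 3)) := by
    refine sum_lt_sum (fun i _ => Fin.le_last (A i)) ⟨i, mem_univ i, ?_⟩
    exact lt_of_le_of_ne (Fin.le_last (A i)) fun h => hi (Fin.ext h)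
  rw [total_two] at this
  omega

/-- The effect of moving the lower rows through the upper ones. With the rows in the opposite order
and the given states on the right, all columns are frozen and have weight `1`, hence the left-hand
side does not depend on the number `L` of columns. -/
theorem prod_mul_eq_sum_fused_transfer {n m : ℕ} {u : ℕ → Fin n → Weights}
    {v : ℕ → Fin m → Weights} {R : Fin m → Fin n → Weights} {κ : Fin m → Fin n → ℂ}
    (hu : ∀ k i, (u k i).Conserving) (hv : ∀ k j, (v k j).Conserving)
    (hu0 : ∀ k i, u k i 0 0 0 0 = 1) (hv2 : ∀ k j, v k j 0 2 0 2 = 1)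
    (hR : ∀ k j i, YangBaxter (u k i) (v k j) (R j i))
    {𝓐 : Type} [Ring 𝓐] [Algebra ℂ 𝓐] {X : Fin n → Fin 3 → 𝓐} {Y : Fin m → Fin 3 → 𝓐}
    (hXY : ∀ j i, Exchange (R j i) (κ j i) (X i) (Y j)) (ℓ : 𝓐 →ₗ[ℂ] ℂ) (L : ℕ) :
    (∏ j, ∏ i, κ j i) * ℓ (orderedProd Y (fun _ => 2) * orderedProd X 0) =
      ∑ A, ∑ B, fused R (fun _ => 2) 0 A B *
        transfer u v (fun I J => ℓ (orderedProd X I * orderedProd Y J)) L A B := by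
  have main : ∃ (𝓑 : Type) (_ : Ring 𝓑) (_ : Algebra ℂ 𝓑) (X' : Fin n → Fin 3 → 𝓑)
      (Y' : Fin m → Fin 3 → 𝓑) (ℓ' : 𝓑 →ₗ[ℂ] ℂ),
      (∀ j i, Exchange (R j i) (κ j i) (X' i) (Y' j)) ∧
      (∀ A B, ℓ' (orderedProd X' A * orderedProd Y' B) =
        transfer u v (fun I J => ℓ (orderedProd X I * orderedProd Y J)) L A B) ∧
      ℓ' (orderedProd Y' (fun _ => 2) * orderedProd X' 0) =
        ℓ (orderedProd Y (fun _ => 2) * orderedProd X 0) := by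
    induction L with
    | zero => exact ⟨𝓐, _, _, X, Y, ℓ, hXY, fun _ _ => rfl, rfl⟩
    | succ L ih =>
      obtain ⟨𝓑, _, _, X', Y', ℓ', h1, h2, h3⟩ := ih
      refine ⟨Matrix (Fin 3) (Fin 3) 𝓑, inferInstance, inferInstance,
        fun i => addColumn (u L i) (X' i), fun j => addColumn (v L j) (Y' j),
        entryFunctional ℓ', fun j i => exchange_addColumn (hR L j i) (h1 j i), fun A B => ?_, ?_⟩
      · simp only [entryFunctional_apply, Matrix.mul_apply, orderedProd_addColumn, transfer,
          ← h2, map_sum, sum_mul_sum, smul_mul_smul_comm, map_smul, smul_eq_mul]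
        simp only [sum_mul]
        rw [sum_comm]
        exact sum_congr rfl fun I _ => sum_comm
      · rw [entryFunctional_apply, ← h3, Matrix.mul_apply, sum_eq_single 0, orderedProd_addColumn,
          orderedProd_addColumn, sum_eq_single (fun _ => 2), sum_eq_single 0,
          columnMatrix_self (hv L), columnMatrix_self (hu L)]
        · simp [hv2, hu0]
        · intro I _ hI
          by_contra hne
          have := total_of_columnMatrix_ne_zero (hu L) (left_ne_zero_of_smul hne)
          exact hI (eq_zero_of_total_eq_zero (by simpa [total] using this))
        · simp
        · intro J _ hJ
          by_contra hne
          have := total_of_columnMatrix_ne_zero (hv L) (left_ne_zero_of_smul hne)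
          rw [total_two] at this
          exact hJ (eq_two_of_total (by simp at this; omega))
        · simp
        · intro s _ hs
          rw [orderedProd_addColumn]
          refine mul_eq_zero_of_left (sum_eq_zero fun J _ => ?_) _
          by_contra hne
          have := total_of_columnMatrix_ne_zero (hv L) (left_ne_zero_of_smul hne)
          rw [total_two] at this
          have h4 := total_le J
          apply hs
          ext
          simp at this ⊢
          omega
        · simp
  obtain ⟨𝓑, _, _, X', Y', ℓ', h1, h2, h3⟩ := main
  have := congrArg ℓ' (exchange_rows h1 (fun _ => 2) 0)
  simpa only [map_smul, map_sum, smul_eq_mul, h2, h3] using this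

/-! ### Partition functions as matrix products -/

/-- An entry of a product of matrices is a sum over paths of indices. -/
theorem list_prod_apply_eq_sum_paths {ι : Type*} [Fintype ι] [DecidableEq ι] {L : ℕ}
    (M : Fin L → Matrix ι ι ℂ) (a b : ι) :
    (List.ofFn M).prod a b = ∑ h : Fin (L + 1) → ι,
      if h 0 = a ∧ h (Fin.last L) = b then ∏ c, M c (h c.castSucc) (h c.succ) else 0 := by
  induction L generalizing a with
  | zero =>
    rw [← (Equiv.funUnique (Fin 1) ι).symm.sum_comp]
    simp only [List.ofFn_zero, List.prod_nil, Matrix.one_apply, univ_eq_empty, prod_empty]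
    rw [sum_eq_single a]
    · simp
    · intro c _ hc
      simp [hc]
    · simp
  | succ L ih =>
    rw [List.ofFn_succ, List.prod_cons, Matrix.mul_apply]
    conv_rhs =>
      rw [← (Fin.consEquiv (fun _ : Fin (L + 2) => ι)).sum_comp, Fintype.sum_prod_type,
        Fintype.sum_eq_single a (fun c hc => by simp [Fin.consEquiv, hc])]
    simp only [ih, mul_sum]
    rw [sum_comm]
    refine sum_congr rfl fun h _ => ?_
    rw [Fintype.sum_eq_single (h 0) (fun c hc => by simp [Ne.symm hc])]
    simp [Fin.consEquiv, Fin.prod_univ_succ, ← Fin.succ_last, Fin.cons_succ]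

/-- The partition function of `L` columns with the states `0` at the bottom and `S` at the top, as a
matrix in the states of the rows on the left and on the right. -/
def latticeMatrix {n : ℕ} (w : ℕ → Fin n → Weights) (S : ℕ → Fin 3) :
    ℕ → Matrix (Fin n → Fin 3) (Fin n → Fin 3) ℂ
  | 0 => 1
  | L + 1 => latticeMatrix w S L * Matrix.of fun I A => columnMatrix (w L) I A 0 (S L)

theorem latticeMatrix_eq_list_prod {n : ℕ} (w : ℕ → Fin n → Weights) (S : ℕ → Fin 3) (L : ℕ) :
    latticeMatrix w S L =
      (List.ofFn fun k : Fin L => Matrix.of fun I A => columnMatrix (w k) I A 0 (S k)).prod := by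
  induction L with
  | zero => simp [latticeMatrix]
  | succ L ih => rw [latticeMatrix, ih, List.ofFn_succ', List.prod_concat]; rfl

theorem columnMatrix_eq_sum {n : ℕ} (w : Fin n → Weights) (I A : Fin n → Fin 3) (b t : Fin 3) :
    columnMatrix w I A b t = ∑ g : Fin (n + 1) → Fin 3,
      if g 0 = b ∧ g (Fin.last n) = t then ∏ i, w i (g i.castSucc) (I i) (g i.succ) (A i) else 0 :=
  list_prod_apply_eq_sum_paths _ _ _

theorem FLeft_eq_latticeMatrix_length (q : ℂ) {N : ℕ} (x : Fin N → ℂ) (z : ℕ → ℂ) (S : NString 2)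
    (J : Fin N → Fin 3) :
    FLeft q x z S J = latticeMatrix (fun k i => W q (x i) (z k)) S S.length J 0 := by
  classical
  rw [latticeMatrix_eq_list_prod, list_prod_apply_eq_sum_paths, FLeft,
    ← (Equiv.piComm fun (_ : Fin (S.length + 1)) (_ : Fin N) => Fin 3).sum_comp]
  refine sum_congr rfl fun h _ => ?_
  rw [← (Equiv.piComm fun (_ : Fin S.length) (_ : Fin (N + 1)) => Fin 3).sum_comp]
  simp only [Matrix.of_apply, columnMatrix_eq_sum, prod_univ_sum, Fintype.piFinset_univ]
  by_cases hh : h 0 = J ∧ h (Fin.last _) = 0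
  · rw [if_pos hh]
    refine sum_congr rfl fun v _ => ?_
    obtain ⟨h1, h2⟩ := hh
    by_cases hv : ∀ c : Fin S.length, v c 0 = 0 ∧ v c (Fin.last N) = S c
    · rw [if_pos, configWeight, prod_comm]
      · exact prod_congr rfl fun c _ => (if_pos (hv c)).symm
      · exact ⟨fun i => congrFun h1 i, fun i => congrFun h2 i, fun c => (hv c).1, fun c => (hv c).2⟩
    · rw [if_neg]
      · push Not at hv
        obtain ⟨c, hc⟩ := hv
        exact (prod_eq_zero (mem_univ c) (if_neg fun h => hc h.1 h.2)).symm
      · exact fun h => hv fun c => ⟨h.2.2.1 c, h.2.2.2 c⟩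
  · rw [if_neg hh]
    refine sum_eq_zero fun v _ => if_neg fun hadm => hh ⟨?_, ?_⟩
    · exact funext hadm.1
    · exact funext hadm.2.1

theorem eq_zero_of_length_le (S : NString 2) {k : ℕ} (h : S.length ≤ k) : S k = 0 := by
  by_contra hne
  have : k + 1 ≤ S.length := Finset.le_sup (f := fun k => k + 1) (Finsupp.mem_support_iff.2 hne)
  omega

/-- The columns beyond the last non-zero component of `S` are frozen. -/
theorem latticeMatrix_apply_zero_of_le {n : ℕ} {w : ℕ → Fin n → Weights}
    (hw : ∀ k i, (w k i).Conserving) (hw0 : ∀ k i, w k i 0 0 0 0 = 1) (S : NString 2) {L : ℕ}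
    (hL : S.length ≤ L) (J : Fin n → Fin 3) :
    latticeMatrix w S L J 0 = latticeMatrix w S S.length J 0 := by
  induction L, hL using Nat.le_induction with
  | base => rfl
  | succ L hL ih =>
    rw [latticeMatrix, Matrix.mul_apply, sum_eq_single 0, ih, Matrix.of_apply,
      eq_zero_of_length_le S hL, columnMatrix_self (hw L)]
    · simp [hw0]
    · intro A _ hA
      refine mul_eq_zero_of_right _ ?_
      rw [Matrix.of_apply]
      by_contra hne
      have := total_of_columnMatrix_ne_zero (hw L) hne
      rw [eq_zero_of_length_le S hL] at this
      exact hA (eq_zero_of_total_eq_zero (by simpa [total] using this))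
    · simp

theorem FLeft_eq_latticeMatrix {q : ℂ} {N : ℕ} {x : Fin N → ℂ} {z : ℕ → ℂ}
    (hw : ∀ k i, Weights.Conserving (W q (x i) (z k))) (S : NString 2) {L : ℕ}
    (hL : S.length ≤ L) (J : Fin N → Fin 3) :
    FLeft q x z S J = latticeMatrix (fun k i => W q (x i) (z k)) S L J 0 := by
  rw [latticeMatrix_apply_zero_of_le (w := fun k i => W q (x i) (z k)) hw (fun _ _ => rfl) S hL,
    FLeft_eq_latticeMatrix_length]

/-! ### Sums over strings for triangular transition matrices -/

section

/-- The strings whose components vanish from the index `L` on. -/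
def stringsBelow (L : ℕ) : Finset (NString 2) := (range L).finsupp fun _ => univ

theorem mem_stringsBelow {L : ℕ} {S : NString 2} : S ∈ stringsBelow L ↔ S.length ≤ L := by
  simp only [stringsBelow, Finset.mem_finsupp_iff, mem_univ, implies_true, and_true,
    NString.length, Finset.sup_le_iff, subset_iff, mem_range, Nat.succ_le_iff]

theorem stringsBelow_zero : stringsBelow 0 = {0} := by
  ext S
  simp [stringsBelow, Finset.mem_finsupp_iff]

theorem sum_stringsBelow_succ {M : Type*} [AddCommMonoid M] (L : ℕ) (f : NString 2 → M) :
    ∑ S ∈ stringsBelow (L + 1), f S = ∑ S ∈ stringsBelow L, ∑ s, f (S.update L s) := by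
  rw [← sum_product']
  refine sum_bij' (fun S _ => (S.erase L, S L)) (fun p _ => p.1.update L p.2) ?_ ?_ ?_ ?_ ?_
  · intro S hS
    simp only [stringsBelow, Finset.mem_finsupp_iff, subset_iff, mem_range, mem_product,
      Finsupp.mem_support_iff] at hS ⊢
    refine ⟨⟨fun k hk => ?_, by simp⟩, by simp⟩
    have hkL : k ≠ L := by rintro rfl; simp at hk
    rw [Finsupp.erase_ne hkL] at hk
    have := hS.1 hk
    omega
  · intro p hp
    simp only [stringsBelow, Finset.mem_finsupp_iff, subset_iff, mem_range, mem_product,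
      Finsupp.mem_support_iff] at hp ⊢
    refine ⟨fun k hk => ?_, by simp⟩
    by_cases hkL : k = L
    · omega
    · rw [Finsupp.update_apply, if_neg hkL] at hk
      have := hp.1.1 hk
      omega
  · intro S _
    ext k
    by_cases hk : k = L <;> simp [hk]
  · rintro ⟨S, s⟩ hp
    simp only [stringsBelow, Finset.mem_finsupp_iff, subset_iff, mem_range, mem_product,
      Finsupp.mem_support_iff] at hp
    refine Prod.ext ?_ (by simp)
    ext k
    by_cases hk : k = L
    · have : S L = 0 := by
        by_contra hne
        exact lt_irrefl _ (hp.1.1 hne)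
      simp [hk, this]
    · simp [hk]
  · intro S _
    congr 1
    ext k
    by_cases hk : k = L <;> simp [hk]

theorem tendsto_stringsBelow : Filter.Tendsto stringsBelow Filter.atTop Filter.atTop := by
  refine Filter.tendsto_atTop_finset_of_monotone (fun a b hab S hS => ?_) fun S => ⟨S.length, ?_⟩
  · exact mem_stringsBelow.2 ((mem_stringsBelow.1 hS).trans hab)
  · exact mem_stringsBelow.2 le_rfl

variable {P : Type*}

/-- Transition matrices `K k s` on the states `P` that are uniformly bounded by `C` and triangular
with respect to `rk`, and that preserve the states in `good`. Their diagonal entries vanish unless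
`s = 0`; in that case, the entry of the base state `p₀` is `1`, and those of the other states in
`good` are at most `ε < 1` in modulus. -/
structure IsDecaying (K : ℕ → Fin 3 → P → P → ℂ) (p₀ : P) (good : P → Prop) (rk : P → ℕ)
    (ε C : ℝ) : Prop where
  good_of_ne_zero : ∀ {k s p p'}, good p → K k s p p' ≠ 0 → good p'
  rank_lt : ∀ {k s p p'}, K k s p p' ≠ 0 → (p' = p ∧ s = 0) ∨ rk p' < rk p
  rank_base : rk p₀ = 0
  norm_le : ∀ k s p p', ‖K k s p p'‖ ≤ C
  norm_diag_le : ∀ k p, good p → p ≠ p₀ → ‖K k 0 p p‖ ≤ ε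
  diag_base : ∀ k, K k 0 p₀ p₀ = 1
  nonneg : 0 ≤ ε
  lt_one : ε < 1

namespace IsDecaying
variable {K : ℕ → Fin 3 → P → P → ℂ} {p₀ : P} {good : P → Prop} {rk : P → ℕ} {ε C : ℝ}

theorem bound_nonneg (h : IsDecaying K p₀ good rk ε C) : 0 ≤ C :=
  (norm_nonneg _).trans (h.norm_le 0 0 p₀ p₀)

theorem sum_norm_self (h : IsDecaying K p₀ good rk ε C) (k : ℕ) (p : P) :
    ∑ s, ‖K k s p p‖ = ‖K k 0 p p‖ := by
  refine Fintype.sum_eq_single 0 fun s hs => ?_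
  rw [norm_eq_zero]
  by_contra hne
  rcases h.rank_lt hne with h1 | h1
  · exact hs h1.2
  · exact lt_irrefl _ h1

theorem sum_norm_le (h : IsDecaying K p₀ good rk ε C) (k : ℕ) (p p' : P) :
    ∑ s, ‖K k s p p'‖ ≤ 3 * C := by
  refine (sum_le_card_nsmul univ _ C fun s _ => h.norm_le k s p p').trans (le_of_eq ?_)
  simp

end IsDecaying

variable [Fintype P]

/-- The row vector `u` multiplied by the transition matrices `K 0 (S 0)`, …,
`K (L - 1) (S (L - 1))`. -/
def propagate (K : ℕ → Fin 3 → P → P → ℂ) (u : P → ℂ) (S : ℕ → Fin 3) : ℕ → P → ℂ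
  | 0 => u
  | L + 1 => fun p' => ∑ p, propagate K u S L p * K L (S L) p p'

theorem propagate_succ (K : ℕ → Fin 3 → P → P → ℂ) (u : P → ℂ) (S : ℕ → Fin 3) (L : ℕ) (p' : P) :
    propagate K u S (L + 1) p' = ∑ p, propagate K u S L p * K L (S L) p p' := rfl

theorem propagate_congr {K : ℕ → Fin 3 → P → P → ℂ} {u : P → ℂ} {S S' : ℕ → Fin 3} {L : ℕ}
    (h : ∀ k < L, S k = S' k) : propagate K u S L = propagate K u S' L := by
  induction L with
  | zero => rfl
  | succ L ih =>
    funext p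
    simp only [propagate, ih fun k hk => h k (by omega), h L (by omega)]

theorem propagate_update (K : ℕ → Fin 3 → P → P → ℂ) (u : P → ℂ) (S : NString 2) (L : ℕ)
    (s : Fin 3) (p' : P) :
    propagate K u (S.update L s) (L + 1) p' = ∑ p, propagate K u S L p * K L s p p' := by
  have : propagate K u (S.update L s) L = propagate K u S L :=
    propagate_congr fun k hk => by simp [Finsupp.update_apply, hk.ne]
  simp only [propagate, this]
  simp [Finsupp.update_apply]

theorem sum_propagate_succ (K : ℕ → Fin 3 → P → P → ℂ) (u : P → ℂ) (L : ℕ) (p' : P) :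
    ∑ S ∈ stringsBelow (L + 1), propagate K u S (L + 1) p' =
      ∑ p, (∑ S ∈ stringsBelow L, propagate K u S L p) * ∑ s, K L s p p' := by
  simp only [sum_stringsBelow_succ, propagate_update, sum_mul_sum]
  rw [sum_comm (s := univ (α := P))]
  exact sum_congr rfl fun S _ => sum_comm

theorem sum_norm_propagate_succ_le (K : ℕ → Fin 3 → P → P → ℂ) (u : P → ℂ) (L : ℕ) (p' : P) :
    ∑ S ∈ stringsBelow (L + 1), ‖propagate K u S (L + 1) p'‖ ≤
      ∑ p, (∑ S ∈ stringsBelow L, ‖propagate K u S L p‖) * ∑ s, ‖K L s p p'‖ := by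
  simp only [sum_stringsBelow_succ, propagate_update, sum_mul_sum]
  rw [sum_comm (s := univ (α := P))]
  refine sum_le_sum fun S _ => ?_
  rw [sum_comm]
  refine sum_le_sum fun s _ => (norm_sum_le _ _).trans (le_of_eq ?_)
  simp only [norm_mul]

namespace IsDecaying
variable {K : ℕ → Fin 3 → P → P → ℂ} {p₀ : P} {good : P → Prop} {rk : P → ℕ} {ε C : ℝ} {u : P → ℂ}

theorem propagate_eq_zero (h : IsDecaying K p₀ good rk ε C)
    (hu : ∀ p, u p ≠ 0 → good p) (S : ℕ → Fin 3) (L : ℕ) {p : P} (hp : ¬ good p) :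
    propagate K u S L p = 0 := by
  induction L generalizing p with
  | zero =>
    by_contra hne
    exact hp (hu p hne)
  | succ L ih =>
    refine sum_eq_zero fun p' _ => ?_
    by_contra hne
    exact hp (h.good_of_ne_zero (not_imp_comm.1 ih (left_ne_zero_of_mul hne))
      (right_ne_zero_of_mul hne))

variable [DecidableEq P]

/-- Away from the base state, the sum over all strings decays geometrically. Triangularity is
exploited by a norm in which each unit of rank costs a small factor `t`, so that the off-diagonal
entries, which lower the rank, hardly contribute. -/
theorem exists_geometric_bound (h : IsDecaying K p₀ good rk ε C)
    (hu : ∀ p, u p ≠ 0 → good p) : ∃ D θ : ℝ, 0 ≤ D ∧ 0 ≤ θ ∧ θ < 1 ∧ ∀ L p, p ≠ p₀ →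
    ∑ S ∈ stringsBelow L, ‖propagate K u S L p‖ ≤ D * θ ^ L := by
  obtain ⟨θ, hεθ, hθ1⟩ := exists_between h.lt_one
  have hC := h.bound_nonneg
  have hθ : 0 < θ := h.nonneg.trans_lt hεθ
  -- the weight `t` per unit of rank makes the off-diagonal transitions contribute less than `θ - ε`
  set Q : ℝ := 3 * C * Fintype.card P + 1 with hQ
  have hQ0 : 0 < Q := by positivity
  obtain ⟨t, ht0, ht1, htQ⟩ : ∃ t : ℝ, 0 < t ∧ t ≤ 1 ∧ t * Q ≤ θ - ε := by
    refine ⟨min 1 ((θ - ε) / Q), lt_min one_pos (div_pos (sub_pos.2 hεθ) hQ0), min_le_left _ _, ?_⟩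
    calc _ ≤ (θ - ε) / Q * Q := by gcongr; exact min_le_right _ _
      _ = _ := div_mul_cancel₀ _ hQ0.ne'
  set D : ℝ := ∑ p, ‖u p‖ / t ^ rk p with hD
  have hD0 : 0 ≤ D := sum_nonneg fun p _ => by positivity
  refine ⟨D, θ, hD0, hθ.le, hθ1, ?_⟩
  suffices key : ∀ L p, p ≠ p₀ →
      ∑ S ∈ stringsBelow L, ‖propagate K u S L p‖ ≤ D * θ ^ L * t ^ rk p by
    intro L p hp
    exact (key L p hp).trans (mul_le_of_le_one_right (by positivity) (pow_le_one₀ ht0.le ht1))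
  intro L
  induction L with
  | zero =>
    intro p _
    rw [stringsBelow_zero, sum_singleton, pow_zero, mul_one, ← div_le_iff₀ (by positivity)]
    exact single_le_sum (f := fun p => ‖u p‖ / t ^ rk p) (fun p _ => by positivity) (mem_univ p)
  | succ L ih =>
    intro p' hp'
    by_cases hgood : good p'
    swap
    · rw [sum_eq_zero fun S _ => by rw [h.propagate_eq_zero hu _ _ hgood, norm_zero]]
      positivity
    refine (sum_norm_propagate_succ_le K u L p').trans ?_
    rw [← add_sum_erase _ _ (mem_univ p'), h.sum_norm_self]
    have h1 : (∑ S ∈ stringsBelow L, ‖propagate K u S L p'‖) * ‖K L 0 p' p'‖ ≤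
        D * θ ^ L * t ^ rk p' * ε :=
      mul_le_mul (ih p' hp') (h.norm_diag_le L p' hgood hp') (norm_nonneg _) (by positivity)
    have h2 : ∀ p ∈ univ.erase p', (∑ S ∈ stringsBelow L, ‖propagate K u S L p‖) *
        ∑ s, ‖K L s p p'‖ ≤ D * θ ^ L * t ^ (rk p' + 1) * (3 * C) := by
      intro p hp
      by_cases hr : rk p' < rk p
      · have hp0 : p ≠ p₀ := by
          rintro rfl
          rw [h.rank_base] at hr
          omega
        refine mul_le_mul ((ih p hp0).trans ?_) (h.sum_norm_le L p p')
          (sum_nonneg fun _ _ => norm_nonneg _) (by positivity)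
        gcongr ?_ * ?_
        exact pow_le_pow_of_le_one ht0.le ht1 hr
      · rw [sum_eq_zero (s := univ) (f := fun s => ‖K L s p p'‖), mul_zero]
        · positivity
        · intro s _
          rw [norm_eq_zero]
          by_contra hne
          rcases h.rank_lt hne with h3 | h3
          · exact (ne_of_mem_erase hp) h3.1.symm
          · exact hr h3
    calc _ ≤ D * θ ^ L * t ^ rk p' * ε +
          Fintype.card P * (D * θ ^ L * t ^ (rk p' + 1) * (3 * C)) := by
          refine add_le_add h1 ((sum_le_card_nsmul _ _ _ h2).trans ?_)
          rw [nsmul_eq_mul]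
          gcongr
          exact card_le_univ _
      _ = D * θ ^ L * t ^ rk p' * (ε + t * (Q - 1)) := by rw [hQ]; ring
      _ ≤ D * θ ^ L * t ^ rk p' * θ := by gcongr; nlinarith
      _ = _ := by ring

theorem tendsto_sum_propagate (h : IsDecaying K p₀ good rk ε C)
    (hu : ∀ p, u p ≠ 0 → good p) {p : P} (hp : p ≠ p₀) :
    Filter.Tendsto (fun L => ∑ S ∈ stringsBelow L, propagate K u S L p) Filter.atTop (nhds 0) := by
  obtain ⟨D, θ, hD, hθ, hθ1, hb⟩ := h.exists_geometric_bound hu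
  refine squeeze_zero_norm (fun L => (norm_sum_le _ _).trans (hb L p hp)) ?_
  simpa using (tendsto_pow_atTop_nhds_zero_of_lt_one hθ hθ1).const_mul D

/-- At the base state, step `L` adds at most a multiple of the geometric bound for the other
states. -/
theorem exists_bound_base (h : IsDecaying K p₀ good rk ε C)
    (hu : ∀ p, u p ≠ 0 → good p) :
    ∃ B : ℝ, ∀ L, ∑ S ∈ stringsBelow L, ‖propagate K u S L p₀‖ ≤ B := by
  obtain ⟨D, θ, hD, hθ, hθ1, hb⟩ := h.exists_geometric_bound hu
  have hC := h.bound_nonneg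
  set E : ℝ := Fintype.card P * (D * (3 * C)) with hE
  have hE0 : 0 ≤ E := by positivity
  have step : ∀ L, ∑ S ∈ stringsBelow L, ‖propagate K u S L p₀‖ ≤
      ‖u p₀‖ + E * ∑ k ∈ range L, θ ^ k := by
    intro L
    induction L with
    | zero => simp [stringsBelow_zero, propagate]
    | succ L ih =>
      refine (sum_norm_propagate_succ_le K u L p₀).trans ?_
      rw [← add_sum_erase _ _ (mem_univ p₀), h.sum_norm_self, h.diag_base, norm_one, mul_one,
        sum_range_succ, mul_add, ← add_assoc]
      refine add_le_add ih ((sum_le_card_nsmul _ _ (D * θ ^ L * (3 * C)) fun p hp => ?_).trans ?_)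
      · exact mul_le_mul (hb L p (ne_of_mem_erase hp)) (h.sum_norm_le L p p₀)
          (sum_nonneg fun _ _ => norm_nonneg _) (by positivity)
      · rw [nsmul_eq_mul, hE]
        calc _ ≤ (Fintype.card P : ℝ) * (D * θ ^ L * (3 * C)) := by
              gcongr
              exact card_le_univ _
          _ = _ := by ring
  refine ⟨‖u p₀‖ + E * (1 - θ)⁻¹, fun L => (step L).trans ?_⟩
  gcongr
  rw [← tsum_geometric_of_lt_one hθ hθ1]
  exact (summable_geometric_of_lt_one hθ hθ1).sum_le_tsum _ fun _ _ => by positivity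

theorem summable (h : IsDecaying K p₀ good rk ε C)
    (hu : ∀ p, u p ≠ 0 → good p) {f : NString 2 → ℂ}
    (hf : ∀ S L, S.length ≤ L → f S = propagate K u S L p₀) : Summable f := by
  obtain ⟨B, hB⟩ := h.exists_bound_base hu
  refine Summable.of_norm (summable_of_sum_le (c := B) (fun _ => norm_nonneg _) fun F => ?_)
  obtain ⟨L, hL⟩ := (Filter.tendsto_atTop.1 tendsto_stringsBelow F).exists
  calc ∑ S ∈ F, ‖f S‖ ≤ ∑ S ∈ stringsBelow L, ‖f S‖ :=
        sum_le_sum_of_subset_of_nonneg hL fun _ _ _ => norm_nonneg _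
    _ = ∑ S ∈ stringsBelow L, ‖propagate K u S L p₀‖ :=
        sum_congr rfl fun S hS => by rw [hf S L (mem_stringsBelow.1 hS)]
    _ ≤ B := hB L

/-- If a linear combination of the sums over all strings with `L` letters is independent of `L`,
then in the limit only the base state contributes to it, which determines the sum of the series. -/
theorem hasSum (h : IsDecaying K p₀ good rk ε C)
    (hu : ∀ p, u p ≠ 0 → good p) {f : NString 2 → ℂ}
    (hf : ∀ S L, S.length ≤ L → f S = propagate K u S L p₀) {r : P → ℂ} {c : ℂ}
    (hr : ∀ L, ∑ p, r p * ∑ S ∈ stringsBelow L, propagate K u S L p = c) (hr0 : r p₀ ≠ 0) :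
    HasSum f (c / r p₀) := by
  have hs := (h.summable hu hf).hasSum
  have h1 : Filter.Tendsto (fun L => ∑ S ∈ stringsBelow L, propagate K u S L p₀) Filter.atTop
      (nhds (∑' S, f S)) :=
    (hs.comp tendsto_stringsBelow).congr fun L =>
      sum_congr rfl fun S hS => hf S L (mem_stringsBelow.1 hS)
  have h2 : Filter.Tendsto (fun L => ∑ p, r p * ∑ S ∈ stringsBelow L, propagate K u S L p)
      Filter.atTop (nhds (∑ p, r p * if p = p₀ then ∑' S, f S else 0)) := by
    refine tendsto_finsetSum _ fun p _ => Filter.Tendsto.const_mul _ ?_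
    split_ifs with hp
    · rw [hp]
      exact h1
    · exact h.tendsto_sum_propagate hu hp
  simp only [hr, mul_ite, mul_zero, sum_ite_eq', mem_univ, if_true] at h2
  rw [tendsto_nhds_unique tendsto_const_nhds h2, mul_div_cancel_left₀ _ hr0]
  exact hs
end IsDecaying

end

/-! ### Turning rows upside down -/

theorem conserving_W (q x y : ℂ) : Weights.Conserving (W q x y) := by
  intro i j k l h
  by_contra hne
  refine h ?_
  fin_cases i <;> fin_cases j <;> fin_cases k <;> fin_cases l <;>
    first | rfl | exact absurd rfl hne

/-- The states of rows turned upside down: the order of the rows is reversed and each state is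
replaced by its complement. -/
def reflect {n : ℕ} (J : Fin n → Fin 3) (j : Fin n) : Fin 3 := (J j.rev).rev

theorem reflect_reflect {n : ℕ} (J : Fin n → Fin 3) : reflect (reflect J) = J := by
  funext j
  simp [reflect]

/-- The involution `reflect` as an equivalence. -/
def reflectEquiv (n : ℕ) : (Fin n → Fin 3) ≃ (Fin n → Fin 3) :=
  ⟨reflect, reflect, reflect_reflect, reflect_reflect⟩

theorem reflect_zero (n : ℕ) : reflect (0 : Fin n → Fin 3) = fun _ => 2 := rfl

theorem cototal_reflect {n : ℕ} (J : Fin n → Fin 3) : cototal (reflect J) = total J := by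
  rw [cototal, total, ← Equiv.sum_comp Fin.revPerm]
  refine sum_congr rfl fun j _ => ?_
  simp only [reflect, Fin.revPerm_apply, Fin.rev_rev, Fin.val_rev]
  omega

theorem total_reflect {n : ℕ} (J : Fin n → Fin 3) : total (reflect J) + total J = 2 * n := by
  rw [← cototal_reflect J, total, cototal, ← sum_add_distrib, sum_congr rfl fun j _ =>
    show (reflect J j : ℕ) + (2 - (reflect J j : ℕ)) = 2 by omega]
  simp [mul_comm]

theorem inv_reflect {n : ℕ} (J : Fin n → Fin 3) : inv (reflect J) = inv J := by
  rw [inv, inv, sum_comm, ← Equiv.sum_comp Fin.revPerm]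
  refine sum_congr rfl fun i _ => ?_
  rw [← Equiv.sum_comp Fin.revPerm]
  refine sum_congr rfl fun j _ => ?_
  simp only [reflect, Fin.revPerm_apply, Fin.rev_rev, Fin.val_rev, Fin.rev_lt_rev]
  split_ifs
  · rw [mul_comm]
    congr 1 <;> omega
  · rfl

theorem kappa_rev (q : ℂ) (a : Fin 3) : kappa q a.rev = kappa q a := by
  fin_cases a <;> rfl

theorem prod_kappa_reflect (q : ℂ) {n : ℕ} (J : Fin n → Fin 3) :
    ∏ j, kappa q (reflect J j) = ∏ j, kappa q (J j) := by
  rw [← Equiv.prod_comp Fin.revPerm]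
  simp [reflect, kappa_rev]

/-- The weights of a vertex turned upside down, with complementary states on the horizontal
edges. -/
def Weights.crossed (w : Weights) : Weights := fun i j k l => w k j.rev i l.rev

theorem ofFn_rev {α : Type*} {n : ℕ} (f : Fin n → α) :
    List.ofFn (fun j => f j.rev) = (List.ofFn f).reverse := by
  refine List.ext_getElem (by simp) fun j h1 h2 => ?_
  simp only [List.getElem_ofFn, List.getElem_reverse, List.length_ofFn, Fin.rev]
  congr 2
  omega

theorem columnMatrix_crossed {n : ℕ} (w : Fin n → Weights) (I A : Fin n → Fin 3) :
    columnMatrix (fun j => (w j.rev).crossed) (reflect I) (reflect A) =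
      (columnMatrix w I A).transpose := by
  rw [columnMatrix, columnMatrix, Matrix.transpose_list_prod, List.map_ofFn]
  rw [← ofFn_rev]
  congr 2
  funext j
  ext i k
  simp [vertexMatrix, Weights.crossed, reflect]

/-- If the weights `w'` and `w` differ by a gauge transformation `g` of the vertical edges and a
factor `c ^ l`, the gauge factors of the inner edges of a column cancel. -/
theorem columnMatrix_gauge {n : ℕ} {w w' : Fin n → Weights} {g : Fin 3 → ℂ} {c : ℂ}
    (h : ∀ r i j k l, w' r i j k l * g i = c ^ (l : ℕ) * g k * w r i j k l)
    (I A : Fin n → Fin 3) (b t : Fin 3) :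
    columnMatrix w' I A b t * g b = c ^ total A * g t * columnMatrix w I A b t := by
  induction n generalizing b with
  | zero =>
    by_cases hbt : b = t <;> simp [columnMatrix, total, hbt]
  | succ n ih =>
    rw [columnMatrix_succ_apply, columnMatrix_succ_apply, total_succ, sum_mul, mul_sum]
    refine sum_congr rfl fun s _ => ?_
    have h1 := ih (w := Fin.tail w) (w' := Fin.tail w') (fun r => h r.succ) (Fin.tail I)
      (Fin.tail A) s
    have h2 := h 0 b (I 0) s (A 0)
    rw [pow_add]
    linear_combination columnMatrix (Fin.tail w') (Fin.tail I) (Fin.tail A) s t * h2 +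
      c ^ (A 0 : ℕ) * w 0 b (I 0) s (A 0) * h1

/-! ### Bounds on the weights -/

theorem polyW_eq_quadratic (q x y : ℂ) (i j k l : Fin 3) :
    polyW q x y i j k l = polyW q 1 0 i j k l * x ^ 2 +
      (polyW q 1 1 i j k l - polyW q 1 0 i j k l - polyW q 0 1 i j k l) * (x * y) +
      polyW q 0 1 i j k l * y ^ 2 := by
  by_cases hc : (i + j : ℕ) = k + l
  · fin_cases i <;> fin_cases j <;> fin_cases k <;> fin_cases l <;>
    first
    | exact absurd hc (by decide)
    | (simp only [Fin.zero_eta, Fin.mk_one, Fin.reduceFinMk, polyW_values]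
       ring)
  · simp [polyW_eq_zero _ _ _ hc]

theorem exists_norm_polyW_le (q : ℂ) :
    ∃ c : ℝ, 0 ≤ c ∧ ∀ x y i j k l, ‖polyW q x y i j k l‖ ≤ c * (‖x‖ + ‖y‖) ^ 2 := by
  set a : ℂ → ℂ → ℝ := fun x y => ∑ i, ∑ j, ∑ k, ∑ l, ‖polyW q x y i j k l‖ with ha
  have hle : ∀ x y i j k l, ‖polyW q x y i j k l‖ ≤ a x y := by
    intro x y i j k l
    refine le_trans ?_ (single_le_sum (f := fun i => ∑ j, ∑ k, ∑ l, ‖polyW q x y i j k l‖)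
      (fun _ _ => by positivity) (mem_univ i))
    refine le_trans ?_ (single_le_sum (f := fun j => ∑ k, ∑ l, ‖polyW q x y i j k l‖)
      (fun _ _ => by positivity) (mem_univ j))
    refine le_trans ?_ (single_le_sum (f := fun k => ∑ l, ‖polyW q x y i j k l‖)
      (fun _ _ => by positivity) (mem_univ k))
    exact single_le_sum (f := fun l => ‖polyW q x y i j k l‖)
      (fun _ _ => by positivity) (mem_univ l)
  have ha0 : ∀ x y, 0 ≤ a x y := fun x y => by positivity
  refine ⟨a 1 0 + a 1 1 + a 0 1, by linarith [ha0 1 0, ha0 1 1, ha0 0 1],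
    fun x y i j k l => ?_⟩
  rw [polyW_eq_quadratic]
  have h10 := hle 1 0 i j k l
  have h11 := hle 1 1 i j k l
  have h01 := hle 0 1 i j k l
  have hx := norm_nonneg x
  have hy := norm_nonneg y
  calc _ ≤ a 1 0 * ‖x‖ ^ 2 + (a 1 1 + a 1 0 + a 0 1) * (‖x‖ * ‖y‖) + a 0 1 * ‖y‖ ^ 2 := by
        refine (norm_add₃_le).trans ?_
        simp only [norm_mul, norm_pow]
        gcongr
        exact (norm_sub_le _ _).trans
          (add_le_add ((norm_sub_le _ _).trans (add_le_add h11 h10)) h01)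
    _ ≤ _ := by
        have := mul_nonneg (ha0 1 1) (mul_nonneg hx hy)
        have := mul_nonneg (ha0 1 0) (mul_nonneg hx hy)
        have := mul_nonneg (ha0 0 1) (mul_nonneg hx hy)
        have := mul_nonneg (ha0 1 1) (sq_nonneg ‖x‖)
        have := mul_nonneg (ha0 1 0) (sq_nonneg ‖y‖)
        have := mul_nonneg (ha0 0 1) (sq_nonneg ‖x‖)
        have := mul_nonneg (ha0 1 1) (sq_nonneg ‖y‖)
        nlinarith

theorem norm_columnMatrix_le {n : ℕ} {w : Fin n → Weights} {c : ℝ}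
    (h : ∀ r i j k l, ‖w r i j k l‖ ≤ c) (I A : Fin n → Fin 3) (b t : Fin 3) :
    ‖columnMatrix w I A b t‖ ≤ (3 * c) ^ n := by
  induction n generalizing b with
  | zero => by_cases hbt : b = t <;> simp [columnMatrix, hbt]
  | succ n ih =>
    have hc : 0 ≤ c := (norm_nonneg _).trans (h 0 0 0 0 0)
    rw [columnMatrix_succ_apply]
    refine (norm_sum_le _ _).trans ((sum_le_card_nsmul _ _ (c * (3 * c) ^ n) fun s _ => ?_).trans
      (le_of_eq ?_))
    · rw [norm_mul]
      exact mul_le_mul (h _ _ _ _ _) (ih (w := Fin.tail w) (fun r => h r.succ) _ _ _)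
        (norm_nonneg _) hc
    · simp
      ring

theorem exists_norm_W_le {q : ℂ} {ι : Type*} {x : ι → ℂ} {y : ℕ → ℂ} {δ : ℝ} (hδ : 0 < δ)
    (hy : ∀ k, y k ≠ 0)
    (h : ∀ i k, δ * (‖x i‖ + ‖y k‖) ^ 2 ≤ ‖(x i - q ^ 2 * y k) * (x i - q ^ 3 * y k)‖) :
    ∃ c : ℝ, ∀ r n i j k l, ‖W q (x r) (y n) i j k l‖ ≤ c := by
  obtain ⟨c, hc0, hc⟩ := exists_norm_polyW_le q
  refine ⟨c / δ, fun r n i j k l => ?_⟩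
  have hpos : 0 < (‖x r‖ + ‖y n‖) ^ 2 := by
    have := norm_pos_iff.2 (hy n)
    positivity
  have hD := (mul_pos hδ hpos).trans_le (h r n)
  rw [W_eq_polyW_div (norm_pos_iff.1 hD), norm_div, div_le_div_iff₀ hD hδ]
  calc _ ≤ c * (‖x r‖ + ‖y n‖) ^ 2 * δ := by gcongr; exact hc _ _ _ _ _ _
    _ = c * (δ * (‖x r‖ + ‖y n‖) ^ 2) := by ring
    _ ≤ _ := by gcongr; exact h r n

/-- Splitting off the factor of row `i`, which leaves the state `0` behind. -/
theorem prod_update_zero {n : ℕ} {a : Fin n → Fin 3 → ℝ} (ha : ∀ i, a i 0 = 1) (I : Fin n → Fin 3)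
    (i : Fin n) : ∏ r, a r (I r) = a i (I i) * ∏ r, a r (Function.update I i 0 r) := by
  rw [← mul_prod_erase univ (fun r => a r (I r)) (mem_univ i),
    ← mul_prod_erase univ (fun r => a r (Function.update I i 0 r)) (mem_univ i),
    Function.update_self, ha, one_mul]
  congr 1
  exact prod_congr rfl fun r hr => by rw [Function.update_of_ne (ne_of_mem_erase hr)]

theorem total_update_zero {n : ℕ} (I : Fin n → Fin 3) (i : Fin n) :
    total I = I i + total (Function.update I i 0) := by
  rw [total, total, ← add_sum_erase univ (fun r => (I r : ℕ)) (mem_univ i),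
    ← add_sum_erase univ (fun r => (Function.update I i 0 r : ℕ)) (mem_univ i),
    Function.update_self, Fin.val_zero, zero_add]
  congr 1
  exact sum_congr rfl fun r hr => by rw [Function.update_of_ne (ne_of_mem_erase hr)]

theorem exists_ne_of_total {n : ℕ} {I : Fin n → Fin 3} (h : 1 < total I) {i : Fin n}
    (hi : I i = 1) : ∃ i', i' ≠ i ∧ I i' ≠ 0 := by
  by_contra! hne
  have h1 : total (Function.update I i 0) = 0 := by
    refine sum_eq_zero fun r _ => ?_
    by_cases hr : r = i
    · simp [hr]
    · simp [Function.update_of_ne hr, hne r hr]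
  have := total_update_zero I i
  rw [h1, hi] at this
  simp at this
  omega

theorem exists_ne_zero_of_total_pos {n : ℕ} {I : Fin n → Fin 3} (h : 0 < total I) :
    ∃ i, I i ≠ 0 := by
  by_contra! hne
  rw [show I = 0 from funext hne] at h
  simp [total] at h

/-- The rows in the states `1` and `2` on the two sides can be matched in groups, each of which
contributes a factor of at most `ε`: as long as both sides have an entry `1` or both have an entry
`2`, such a pair is split off; otherwise one side has only entries `1` and the other only entries
`2`, and one `2` is matched with two `1`. -/
theorem prod_mul_prod_le {n m : ℕ} {a : Fin n → Fin 3 → ℝ} {b : Fin m → Fin 3 → ℝ} {ε : ℝ}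
    (hε : ε ≤ 1) (ha0 : ∀ i s, 0 ≤ a i s) (hb0 : ∀ j s, 0 ≤ b j s)
    (ha : ∀ i, a i 0 = 1) (hb : ∀ j, b j 0 = 1)
    (h11 : ∀ i j, a i 1 * b j 1 ≤ ε) (h22 : ∀ i j, a i 2 * b j 2 ≤ ε)
    (h112 : ∀ i i' j, i ≠ i' → a i 1 * a i' 1 * b j 2 ≤ ε)
    (h211 : ∀ i j j', j ≠ j' → a i 2 * (b j 1 * b j' 1) ≤ ε)
    (I : Fin n → Fin 3) (J : Fin m → Fin 3) (hIJ : total I = total J) :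
    (∏ i, a i (I i)) * ∏ j, b j (J j) ≤ if total I = 0 then 1 else ε := by
  induction hk : total I using Nat.strong_induction_on generalizing I J with
  | _ k ih =>
  subst hk
  split_ifs with h0
  · have hJ := eq_zero_of_total_eq_zero (hIJ ▸ h0 : total J = 0)
    have hI := eq_zero_of_total_eq_zero h0
    simp [hI, hJ, ha, hb]
  have ih' : ∀ I' J', total I' = total J' → total I' < total I →
      (∏ i, a i (I' i)) * ∏ j, b j (J' j) ≤ 1 := by
    intro I' J' h1 h2
    refine (ih _ h2 I' J' h1 rfl).trans ?_
    split_ifs <;> linarith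
  -- once a matched group of entries contributes at most `ε`, the remaining entries contribute
  -- at most `1` by induction
  have finish : ∀ c I' J', 0 ≤ c → c ≤ ε → total I' = total J' → total I' < total I →
      (∏ i, a i (I i)) * ∏ j, b j (J j) = c * ((∏ i, a i (I' i)) * ∏ j, b j (J' j)) →
      (∏ i, a i (I i)) * ∏ j, b j (J j) ≤ ε := by
    intro c I' J' hc0 hc h1 h2 h3
    rw [h3]
    exact (mul_le_of_le_one_right hc0 (ih' I' J' h1 h2)).trans hc
  have same : ∀ s : Fin 3, s ≠ 0 → (∀ i j, a i s * b j s ≤ ε) → ∀ i j, I i = s → J j = s →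
      (∏ i, a i (I i)) * ∏ j, b j (J j) ≤ ε := by
    intro s hs hab i j hi hj
    have h1 := total_update_zero I i
    have h2 := total_update_zero J j
    have hs' : 0 < (s : ℕ) := Nat.pos_of_ne_zero fun h => hs (Fin.ext h)
    rw [hi] at h1
    rw [hj] at h2
    refine finish (a i s * b j s) (Function.update I i 0) (Function.update J j 0)
      (mul_nonneg (ha0 _ _) (hb0 _ _)) (hab i j) (by omega) (by omega) ?_
    rw [prod_update_zero ha I i, prod_update_zero hb J j, hi, hj]
    ring
  have cases3 : ∀ s : Fin 3, s = 0 ∨ s = 1 ∨ s = 2 := by decide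
  by_cases m1 : ∃ i j, I i = 1 ∧ J j = 1
  · obtain ⟨i, j, hi, hj⟩ := m1
    exact same 1 (by decide) h11 i j hi hj
  by_cases m2 : ∃ i j, I i = 2 ∧ J j = 2
  · obtain ⟨i, j, hi, hj⟩ := m2
    exact same 2 (by decide) h22 i j hi hj
  push Not at m1 m2
  obtain ⟨i, hi⟩ := exists_ne_zero_of_total_pos (Nat.pos_of_ne_zero h0)
  obtain ⟨j, hj⟩ := exists_ne_zero_of_total_pos (hIJ ▸ Nat.pos_of_ne_zero h0 : 0 < total J)
  rcases cases3 (I i) with h | h | h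
  · exact absurd h hi
  · have hj2 : J j = 2 := by
      rcases cases3 (J j) with h' | h' | h'
      · exact absurd h' hj
      · exact absurd h' (m1 i j h)
      · exact h'
    have hJ2 := total_update_zero J j
    rw [hj2] at hJ2
    obtain ⟨i', hne, hi'⟩ := exists_ne_of_total (I := I) (by simp at hJ2; omega) h
    have hi1 : I i' = 1 := by
      rcases cases3 (I i') with h' | h' | h'
      · exact absurd h' hi'
      · exact h'
      · exact absurd hj2 (m2 i' j h')
    have e1 := total_update_zero I i
    have e2 := total_update_zero (Function.update I i 0) i'
    have e3 := prod_update_zero ha I i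
    have e4 := prod_update_zero ha (Function.update I i 0) i'
    rw [Function.update_of_ne hne, hi1] at e2 e4
    rw [h] at e1 e3
    refine finish (a i 1 * a i' 1 * b j 2) (Function.update (Function.update I i 0) i' 0)
      (Function.update J j 0) (mul_nonneg (mul_nonneg (ha0 _ _) (ha0 _ _)) (hb0 _ _))
      (h112 i i' j hne.symm) ?_ ?_ ?_
    · simp at e1 e2 hJ2
      omega
    · simp at e1 e2
      omega
    · rw [e3, e4, prod_update_zero hb J j, hj2]
      ring
  · have hj1 : J j = 1 := by
      rcases cases3 (J j) with h' | h' | h'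
      · exact absurd h' hj
      · exact h'
      · exact absurd h' (m2 i j h)
    have hI2 := total_update_zero I i
    rw [h] at hI2
    obtain ⟨j', hne, hj'⟩ := exists_ne_of_total (I := J) (by simp at hI2; omega) hj1
    have hj1' : J j' = 1 := by
      rcases cases3 (J j') with h' | h' | h'
      · exact absurd h' hj'
      · exact h'
      · exact absurd h' (m2 i j' h)
    have e1 := total_update_zero J j
    have e2 := total_update_zero (Function.update J j 0) j'
    have e3 := prod_update_zero hb J j
    have e4 := prod_update_zero hb (Function.update J j 0) j'
    rw [Function.update_of_ne hne, hj1'] at e2 e4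
    rw [hj1] at e1 e3
    refine finish (a i 2 * (b j 1 * b j' 1)) (Function.update I i 0)
      (Function.update (Function.update J j 0) j' 0)
      (mul_nonneg (ha0 _ _) (mul_nonneg (hb0 _ _) (hb0 _ _)))
      (h211 i j j' hne.symm) ?_ ?_ ?_
    · simp at e1 e2 hI2
      omega
    · simp at hI2
      omega
    · rw [e3, e4, prod_update_zero ha I i, h]
      ring

/-! ### The lattice of all rows -/

/-- The weights of an upper row: the row `y` over the column `q⁻³ z⁻¹`, turned upside down. -/
def dualW (q y z : ℂ) : Weights := fun i j k l =>
  polyW q 1 (y * z) i j k l / ((1 - y * z) * (1 - q * y * z))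

theorem dualW_eq_crossed (q y z : ℂ) : dualW q y z = (dualW q y z).crossed.crossed := by
  funext i j k l
  simp [Weights.crossed]

theorem conserving_dualW (q y z : ℂ) : Weights.Conserving (dualW q y z) := by
  intro i j k l h
  exact conserving_polyW _ _ _ fun h0 => h (by rw [dualW, h0, zero_div])

theorem dualW_two {q y z : ℂ} (h : (1 - y * z) * (1 - q * y * z) ≠ 0) :
    dualW q y z 0 2 0 2 = 1 := by
  rw [dualW, div_eq_one_iff_eq h]
  simp only [polyW_values]
  ring

theorem yangBaxter_W_dualW {q x z : ℂ} (h : (x - q ^ 2 * z) * (x - q ^ 3 * z) ≠ 0) (y : ℂ) :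
    YangBaxter (W q x z) (dualW q y z) (polyW q 1 (x * y)) := by
  intro i a b k c d
  have key := polyW_yangBaxter q x y z i a b k c d
  set e := ((x - q ^ 2 * z) * (x - q ^ 3 * z))⁻¹ * ((1 - y * z) * (1 - q * y * z))⁻¹ with he
  calc _ = ∑ a' : Fin 3, ∑ b' : Fin 3, ∑ m : Fin 3, e *
        (polyW q x z i a m a' * polyW q 1 (y * z) m b k b' * polyW q 1 (x * y) a' b' d c) := by
        refine sum_congr rfl fun a' _ => sum_congr rfl fun b' _ => sum_congr rfl fun m _ => ?_
        rw [W_eq_polyW_div h, dualW, he]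
        ring
    _ = ∑ a' : Fin 3, ∑ b' : Fin 3, ∑ m : Fin 3, e *
        (polyW q 1 (x * y) a b b' a' * polyW q 1 (y * z) i a' m c * polyW q x z m b' k d) := by
        simp only [← mul_sum, key]
    _ = _ := by
        refine sum_congr rfl fun a' _ => sum_congr rfl fun b' _ => sum_congr rfl fun m _ => ?_
        rw [W_eq_polyW_div h, dualW, he]
        ring

/-- A column of the upper rows, in terms of the same column before the rows were turned upside
down. -/
theorem columnMatrix_dualW {q z : ℂ} (hq : q ≠ 0) (hq1 : q ≠ 1) (hz : z ≠ 0) {m : ℕ}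
    {y : Fin m → ℂ} (h : ∀ j, (1 - y j * z) * (1 - q * y j * z) ≠ 0) (J B : Fin m → Fin 3)
    (s : Fin 3) :
    columnMatrix (fun j => dualW q (y j.rev) z) (reflect J) (reflect B) s 0 =
      gauge q s * (q ^ 2) ^ total B *
        columnMatrix (fun j => W q (y j) ((q ^ 3)⁻¹ * z⁻¹)) J B 0 s := by
  have h1 := columnMatrix_crossed (fun j => (dualW q (y j) z).crossed) J B
  simp only [← dualW_eq_crossed] at h1
  rw [h1, Matrix.transpose_apply]
  have h2 := columnMatrix_gauge (w := fun j => W q (y j) ((q ^ 3)⁻¹ * z⁻¹))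
    (w' := fun j => (dualW q (y j) z).crossed) (g := gauge q) (c := q ^ 2)
    (fun r i j k l => by
      rw [← pow_mul]
      exact polyW_crossing hq hq1 (y r) hz (h r) i j k l) J B 0 s
  rw [show gauge q 0 = 1 from rfl, mul_one] at h2
  rw [h2]
  ring

section
variable (q : ℂ) {N M : ℕ} (x : Fin N → ℂ) (y : Fin M → ℂ) (z : ℕ → ℂ)

/-- The transition matrix of column `k` for the pair of the states of the `x` rows and the states of
the `y` rows, both families of rows having the top state `s`. -/
def pairStep (k : ℕ) (s : Fin 3) (p p' : (Fin N → Fin 3) × (Fin M → Fin 3)) : ℂ :=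
  columnMatrix (fun i => W q (x i) (z k)) p.1 p'.1 0 s *
    (gauge q s * (q ^ 2) ^ total p'.2 *
      columnMatrix (fun j => W q (y j) ((q ^ 3)⁻¹ * (z k)⁻¹)) p.2 p'.2 0 s)

/-- The left boundary vector of all rows. A pair of states with different totals does not contribute
to states on the right with equal totals, and may be given the value `0`. -/
def pairInit (p : (Fin N → Fin 3) × (Fin M → Fin 3)) : ℂ :=
  if total p.1 = total p.2 then
    (∏ i, kappa q (p.1 i)) * (∏ j, kappa q (p.2 j)) *
      q⁻¹ ^ (inv p.1 + inv p.2 + total p.1 * total p.2)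
  else 0

variable {q x y z}

theorem total_of_pairStep_ne_zero {k : ℕ} {s : Fin 3} {p p' : (Fin N → Fin 3) × (Fin M → Fin 3)}
    (h : pairStep q x y z k s p p' ≠ 0) :
    total p.1 = s + total p'.1 ∧ total p.2 = s + total p'.2 := by
  have h1 := total_of_columnMatrix_ne_zero (fun i => conserving_W q (x i) (z k))
    (left_ne_zero_of_mul h)
  have h2 := total_of_columnMatrix_ne_zero
    (fun j => conserving_W q (y j) ((q ^ 3)⁻¹ * (z k)⁻¹))
    (right_ne_zero_of_mul (right_ne_zero_of_mul h))
  simpa using And.intro h1 h2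

/-- The states of the edges between the lower and the upper rows are the letters of a string. -/
theorem transfer_eq_sum_propagate (hq : q ≠ 0) (hq1 : q ≠ 1) (hz : ∀ k, z k ≠ 0)
    (hy : ∀ k j, (1 - y j * z k) * (1 - q * y j * z k) ≠ 0) (L : ℕ)
    (A : Fin N → Fin 3) (B : Fin M → Fin 3) (hAB : total A = total B) :
    transfer (fun k i => W q (x i) (z k)) (fun k (j : Fin M) => dualW q (y j.rev) (z k))
      (fun I J => vacuumValue
        (orderedProd (fun _ => creation q) I * orderedProd (fun _ => creation q) J))
      L A (reflect B) =
    ∑ S ∈ stringsBelow L, propagate (pairStep q x y z) (pairInit q) S L (A, B) := by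
  induction L generalizing A B with
  | zero =>
    rw [stringsBelow_zero, sum_singleton, transfer, propagate, pairInit, if_pos hAB,
      vacuumValue_creation, inv_reflect, cototal_reflect, prod_kappa_reflect]
  | succ L ih =>
    rw [sum_propagate_succ, transfer, Fintype.sum_prod_type]
    refine sum_congr rfl fun I _ => ?_
    rw [← (reflectEquiv M).sum_comp]
    refine sum_congr rfl fun J _ => ?_
    have h1 : (columnMatrix (fun i => W q (x i) (z L)) I A *
        columnMatrix (fun j : Fin M => dualW q (y j.rev) (z L)) (reflectEquiv M J)
          (reflect B)) 0 0 = ∑ s, pairStep q x y z L s (I, J) (A, B) := by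
      rw [Matrix.mul_apply]
      exact sum_congr rfl fun s _ => congrArg _ (columnMatrix_dualW hq hq1 (hz L) (hy L) J B s)
    rw [h1]
    by_cases hIJ : total I = total J
    · rw [mul_comm]
      exact congrArg (· * _) (ih I J hIJ)
    · rw [sum_eq_zero fun s _ => ?_]
      · simp
      · by_contra hne
        have := total_of_pairStep_ne_zero hne
        simp only at this
        omega

/-- For a given string, the lattice falls apart into the lattices of the `x` rows and of the `y`
rows. By conservation, the factors `q ^ (2 * |B|)` of the single columns collect to one factor
`q ^ (2 * k * S k)` for each column `k`. -/
theorem propagate_pairStep (S : ℕ → Fin 3) (L : ℕ) (A : Fin N → Fin 3) (B : Fin M → Fin 3) :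
    propagate (pairStep q x y z) (pairInit q) S L (A, B) =
      (∑ I, ∑ J, pairInit q (I, J) * (latticeMatrix (fun k i => W q (x i) (z k)) S L I A *
        latticeMatrix (fun k j => W q (y j) ((q ^ 3)⁻¹ * (z k)⁻¹)) S L J B)) *
      ((∏ k ∈ range L, gauge q (S k) * q ^ (2 * k * (S k : ℕ))) * q ^ (2 * L * total B)) := by
  induction L generalizing A B with
  | zero =>
    simp only [propagate, latticeMatrix, Matrix.one_apply, range_zero, prod_empty]
    simp [Finset.sum_ite_eq']
  | succ L ih =>
    have key : ∀ A' B', q ^ (2 * L * total B') * pairStep q x y z L (S L) (A', B') (A, B) =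
        columnMatrix (fun i => W q (x i) (z L)) A' A 0 (S L) *
        columnMatrix (fun j => W q (y j) ((q ^ 3)⁻¹ * (z L)⁻¹)) B' B 0 (S L) *
        (gauge q (S L) * q ^ (2 * L * (S L : ℕ)) * q ^ (2 * (L + 1) * total B)) := by
      intro A' B'
      rw [pairStep]
      by_cases h0 : columnMatrix (fun j => W q (y j) ((q ^ 3)⁻¹ * (z L)⁻¹)) B' B 0 (S L) = 0
      · simp [h0]
      · have h2 := total_of_columnMatrix_ne_zero
          (fun j => conserving_W q (y j) ((q ^ 3)⁻¹ * (z L)⁻¹)) h0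
        rw [Fin.val_zero, zero_add] at h2
        rw [h2]
        ring
    rw [propagate_succ, Fintype.sum_prod_type]
    simp only [ih, latticeMatrix, Matrix.mul_apply, Matrix.of_apply, sum_mul_sum]
    simp only [mul_sum, sum_mul]
    symm
    refine (sum_rotate₄ _).trans ((sum_congr rfl fun B' _ => sum_rotate₃ _).trans
      (sum_comm.trans ?_))
    refine sum_congr rfl fun A' _ => sum_congr rfl fun B' _ => sum_congr rfl fun I _ =>
      sum_congr rfl fun J _ => ?_
    rw [prod_range_succ]
    linear_combination -(pairInit q (I, J) * (latticeMatrix (fun k i => W q (x i) (z k)) S L I A' *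
      latticeMatrix (fun k j => W q (y j) ((q ^ 3)⁻¹ * (z k)⁻¹)) S L J B') *
      ∏ k ∈ range L, gauge q (S k) * q ^ (2 * k * (S k : ℕ))) * key A' B'

end

/-! ### The summands of the series -/

theorem support_subset_range {S : NString 2} {L : ℕ} (hL : S.length ≤ L) : S.support ⊆ range L := by
  intro k hk
  rw [mem_range]
  by_contra hk'
  exact Finsupp.mem_support_iff.1 hk (eq_zero_of_length_le S (by omega))

theorem weight_eq_sum_range {S : NString 2} {L : ℕ} (hL : S.length ≤ L) :
    S.weight = ∑ k ∈ range L, (S k : ℕ) := by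
  refine sum_subset (support_subset_range hL) fun k _ hk => ?_
  rw [Finsupp.notMem_support_iff.1 hk]
  rfl

theorem total_of_latticeMatrix_ne_zero {n : ℕ} {w : ℕ → Fin n → Weights}
    (hw : ∀ k i, (w k i).Conserving) {S : ℕ → Fin 3} {L : ℕ} {I A : Fin n → Fin 3}
    (h : latticeMatrix w S L I A ≠ 0) : total I = ∑ k ∈ range L, (S k : ℕ) + total A := by
  induction L generalizing A with
  | zero =>
    have : I = A := by
      by_contra hne
      simp [latticeMatrix, hne] at h
    simp [this]
  | succ L ih =>
    rw [latticeMatrix, Matrix.mul_apply] at h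
    obtain ⟨A', -, hA'⟩ := exists_ne_zero_of_sum_ne_zero h
    have h1 := ih (left_ne_zero_of_mul hA')
    have h2 := total_of_columnMatrix_ne_zero (hw L) (right_ne_zero_of_mul hA')
    rw [Fin.val_zero, zero_add] at h2
    rw [sum_range_succ]
    omega

/-- The gauge factor of column `k`, distributed over the factors of `halfSign S.weight * cS q S`. -/
theorem gauge_eq (q : ℂ) (a : Fin 3) (k : ℕ) (hq : q ≠ 0) :
    gauge q a * q ^ (2 * k * (a : ℕ)) =
      Complex.I ^ (a : ℕ) * (if a = 1 then Complex.I else 1) * (if a = 1 then (1 - q)⁻¹ else 1) *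
        (if a = 2 then q⁻¹ else 1) * q ^ (2 * (k + 1) * (a : ℕ)) := by
  fin_cases a
  · simp [gauge]
  · change -(q ^ 2 / (1 - q)) * q ^ (2 * k * 1) =
      Complex.I ^ 1 * Complex.I * (1 - q)⁻¹ * 1 * q ^ (2 * (k + 1) * 1)
    rw [show 2 * (k + 1) * 1 = 2 * k * 1 + 2 by ring, pow_add]
    linear_combination (-q ^ (2 * k * 1) * q ^ 2 * (1 - q)⁻¹) * Complex.I_mul_I
  · change -q ^ 3 * q ^ (2 * k * 2) =
      Complex.I ^ 2 * 1 * 1 * q⁻¹ * q ^ (2 * (k + 1) * 2)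
    rw [show 2 * (k + 1) * 2 = 2 * k * 2 + 4 by ring, pow_add, Complex.I_sq]
    field_simp

theorem prod_gauge {q : ℂ} (hq : q ≠ 0) {S : NString 2} {L : ℕ} (hL : S.length ≤ L) :
    ∏ k ∈ range L, gauge q (S k) * q ^ (2 * k * (S k : ℕ)) = halfSign S.weight * cS q S := by
  have h1 : ∀ (a : Fin 3) (c : ℂ),
      c ^ S.count a = ∏ k ∈ S.support, if S k = a then c else 1 := by
    intro a c
    rw [prod_ite, prod_const, prod_const_one, mul_one, NString.count]
  rw [← prod_subset (support_subset_range hL) fun k _ hk => by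
    rw [Finsupp.notMem_support_iff.1 hk]; simp [gauge]]
  simp only [gauge_eq q _ _ hq, prod_mul_distrib, ← h1, prod_pow_eq_pow_sum]
  rw [halfSign, cS, halfSign, NString.weight, prod_pow_eq_pow_sum, inv_pow, inv_pow]
  ring

theorem prod_kappa (q : ℂ) {n : ℕ} (I : Fin n → Fin 3) :
    ∏ i, kappa q (I i) = halfSign (countOnes I) * (1 - q⁻¹) ^ countOnes I := by
  rw [halfSign, ← mul_pow, countOnes, ← prod_const, prod_filter]
  rfl

theorem H_eq_sum_latticeMatrix (q : ℂ) {n : ℕ} (x : Fin n → ℂ) (z : ℕ → ℂ) {S : NString 2} {L : ℕ}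
    (hL : S.length ≤ L) :
    H q x z S = ∑ I, (∏ i, kappa q (I i)) * q⁻¹ ^ inv I *
      latticeMatrix (fun k i => W q (x i) (z k)) S L I 0 := by
  rw [H, sum_filter]
  refine sum_congr rfl fun I _ => ?_
  rw [FLeft_eq_latticeMatrix (fun k i => conserving_W q (x i) (z k)) S hL]
  split_ifs with hI
  · rw [prod_kappa, inv_pow]
  · by_cases h0 : latticeMatrix (fun k i => W q (x i) (z k)) S L I 0 = 0
    · rw [h0, mul_zero]
    · have := total_of_latticeMatrix_ne_zero (fun k i => conserving_W q (x i) (z k)) h0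
      rw [← weight_eq_sum_range hL] at this
      exact absurd (by simpa [total] using this) hI

/-- The summand of the series is, up to the constant `q ^ (4 * M * N)`, the contribution of the
string `S` to the lattice of all rows with the vacuum on the right. -/
theorem halfSign_mul_cS_mul_H_mul_H {q : ℂ} (hq : q ≠ 0) {N M : ℕ} (x : Fin N → ℂ) (y : Fin M → ℂ)
    (z : ℕ → ℂ) {S : NString 2} {L : ℕ} (hL : S.length ≤ L) :
    halfSign S.weight * q ^ (4 * (M : ℤ) * (N : ℤ) - (S.weight : ℤ) ^ 2) * cS q S * H q x z S *
        H q y (fun k => (q ^ 3)⁻¹ * (z k)⁻¹) S =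
      q ^ (4 * M * N) * propagate (pairStep q x y z) (pairInit q) S L (0, 0) := by
  have h1 : q ^ (4 * (M : ℤ) * (N : ℤ) - (S.weight : ℤ) ^ 2) =
      q ^ (4 * M * N) * q⁻¹ ^ (S.weight ^ 2) := by
    rw [zpow_sub₀ hq, div_eq_mul_inv, inv_pow]
    norm_cast
  rw [propagate_pairStep, prod_gauge hq hL, h1, H_eq_sum_latticeMatrix q x z hL,
    H_eq_sum_latticeMatrix q y _ hL, mul_assoc _ (∑ I, _) (∑ I, _), sum_mul_sum]
  have h2 : ∀ I J, pairInit q (I, J) * (latticeMatrix (fun k i => W q (x i) (z k)) S L I 0 *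
      latticeMatrix (fun k j => W q (y j) ((q ^ 3)⁻¹ * (z k)⁻¹)) S L J 0) =
      q⁻¹ ^ (S.weight ^ 2) * ((∏ i, kappa q (I i)) * q⁻¹ ^ inv I *
        latticeMatrix (fun k i => W q (x i) (z k)) S L I 0 *
        ((∏ j, kappa q (J j)) * q⁻¹ ^ inv J *
        latticeMatrix (fun k j => W q (y j) ((q ^ 3)⁻¹ * (z k)⁻¹)) S L J 0)) := by
    intro I J
    by_cases hI : latticeMatrix (fun k i => W q (x i) (z k)) S L I 0 = 0
    · simp [hI]
    by_cases hJ : latticeMatrix (fun k j => W q (y j) ((q ^ 3)⁻¹ * (z k)⁻¹)) S L J 0 = 0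
    · simp [hJ]
    have hI' := total_of_latticeMatrix_ne_zero (fun k i => conserving_W q (x i) (z k)) hI
    have hJ' := total_of_latticeMatrix_ne_zero
      (fun k j => conserving_W q (y j) ((q ^ 3)⁻¹ * (z k)⁻¹)) hJ
    rw [← weight_eq_sum_range hL] at hI' hJ'
    have h0 : ∀ n, total (0 : Fin n → Fin 3) = 0 := fun n => by simp [total]
    rw [h0, add_zero] at hI' hJ'
    rw [pairInit, if_pos (hI'.trans hJ'.symm), hI', hJ', pow_add, pow_add, ← sq]
    ring
  simp only [h2, ← mul_sum]
  simp only [total, Pi.zero_apply, Fin.val_zero, sum_const_zero, mul_zero, pow_zero]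
  ring

/-! ### Decay of the transition matrices -/

theorem isDecaying_pairStep {N M : ℕ} {q : ℂ} (hq : q ≠ 0) {x : Fin N → ℂ} {y : Fin M → ℂ}
    {z : ℕ → ℂ} (hz : ∀ k, z k ≠ 0) {δ : ℝ} (hδ : 0 < δ)
    (hx_pole : ∀ i k, δ * (‖x i‖ + ‖z k‖) ^ 2 ≤ ‖(x i - q ^ 2 * z k) * (x i - q ^ 3 * z k)‖)
    (hy_pole : ∀ j k, δ * (1 + ‖y j * z k‖) ^ 2 ≤ ‖(1 - y j * z k) * (1 - q * y j * z k)‖)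
    (hy : ∀ j k, (1 - y j * z k) * (1 - q * y j * z k) ≠ 0)
    {ε : ℝ} (hε0 : 0 ≤ ε) (hε : ε < 1)
    (h11 : ∀ i j k,
      ‖(1 - q ^ 3 * y j * z k) / (1 - q * y j * z k) * ((x i - z k) / (x i - q ^ 2 * z k))‖ < ε)
    (h22 : ∀ i j k,
      ‖((1 - q ^ 2 * y j * z k) * (1 - q ^ 3 * y j * z k)) /
            ((1 - y j * z k) * (1 - q * y j * z k)) *
          (((x i - z k) * (x i - q * z k)) / ((x i - q ^ 2 * z k) * (x i - q ^ 3 * z k)))‖ < ε)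
    (h112 : ∀ i i' j k, i ≠ i' →
      ‖((1 - q ^ 2 * y j * z k) * (1 - q ^ 3 * y j * z k)) /
            ((1 - y j * z k) * (1 - q * y j * z k)) *
          ((x i - z k) / (x i - q ^ 2 * z k)) * ((x i' - z k) / (x i' - q ^ 2 * z k))‖ < ε)
    (h211 : ∀ i j j' k, j ≠ j' →
      ‖(1 - q ^ 3 * y j * z k) / (1 - q * y j * z k) *
          ((1 - q ^ 3 * y j' * z k) / (1 - q * y j' * z k)) *
          (((x i - z k) * (x i - q * z k)) / ((x i - q ^ 2 * z k) * (x i - q ^ 3 * z k)))‖ < ε) :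
    ∃ C : ℝ, IsDecaying (pairStep q x y z) (0, 0) (fun p => total p.1 = total p.2)
      (fun p => rank p.1 + rank p.2) ε C := by
  have hconsx := fun k i => conserving_W q (x i) (z k)
  have hconsy := fun k j => conserving_W q (y j) ((q ^ 3)⁻¹ * (z k)⁻¹)
  have hz' : ∀ k, (q ^ 3)⁻¹ * (z k)⁻¹ ≠ 0 := fun k =>
    mul_ne_zero (inv_ne_zero (pow_ne_zero _ hq)) (inv_ne_zero (hz k))
  obtain ⟨cx, hcx⟩ := exists_norm_W_le hδ hz hx_pole
  -- the pole condition for the `y` rows, in the variables of the vertex weights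
  obtain ⟨cy, hcy⟩ : ∃ c : ℝ, ∀ r n i j k l, ‖W q (y r) ((q ^ 3)⁻¹ * (z n)⁻¹) i j k l‖ ≤ c := by
    have hq0 : 0 < ‖q‖ := norm_pos_iff.2 hq
    refine exists_norm_W_le (δ := δ * ‖q‖⁻¹ / (1 + (‖q‖ ^ 3)⁻¹) ^ 2) (by positivity) hz'
      fun j k => ?_
    have hz0 : 0 < ‖z k‖ := norm_pos_iff.2 (hz k)
    have e1 : (y j - q ^ 2 * ((q ^ 3)⁻¹ * (z k)⁻¹)) * (y j - q ^ 3 * ((q ^ 3)⁻¹ * (z k)⁻¹)) =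
        (1 - y j * z k) * (1 - q * y j * z k) * (q⁻¹ * (z k)⁻¹ ^ 2) := by
      have := hz k
      field_simp
      ring
    rw [e1]
    have e2 : ‖y j‖ + ‖(q ^ 3)⁻¹ * (z k)⁻¹‖ ≤
        (1 + ‖y j * z k‖) * (1 + (‖q‖ ^ 3)⁻¹) * ‖z k‖⁻¹ := by
      rw [norm_mul, norm_inv, norm_inv, norm_pow, norm_mul]
      have : ‖y j‖ = ‖y j‖ * ‖z k‖ * ‖z k‖⁻¹ := by field_simp
      nth_rewrite 1 [this]
      rw [← add_mul]
      gcongr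
      have h1 := mul_nonneg (norm_nonneg (y j)) (norm_nonneg (z k))
      have h2 : 0 ≤ (‖q‖ ^ 3)⁻¹ := by positivity
      nlinarith [mul_nonneg h1 h2]
    calc _ ≤ δ * ‖q‖⁻¹ / (1 + (‖q‖ ^ 3)⁻¹) ^ 2 *
          ((1 + ‖y j * z k‖) * (1 + (‖q‖ ^ 3)⁻¹) * ‖z k‖⁻¹) ^ 2 :=
        mul_le_mul_of_nonneg_left (pow_le_pow_left₀ (by positivity) e2 2) (by positivity)
      _ = δ * (1 + ‖y j * z k‖) ^ 2 * (‖q‖⁻¹ * ‖z k‖⁻¹ ^ 2) := by field_simp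
      _ ≤ ‖(1 - y j * z k) * (1 - q * y j * z k)‖ * ‖q⁻¹ * (z k)⁻¹ ^ 2‖ := by
        rw [norm_mul q⁻¹, norm_pow, norm_inv, norm_inv]
        gcongr
        exact hy_pole j k
      _ = _ := (norm_mul _ _).symm
  set g : ℝ := ∑ s, ‖gauge q s‖ with hg
  set b : ℝ := ∑ B : Fin M → Fin 3, ‖(q ^ 2) ^ total B‖ with hb
  refine ⟨(3 * cx) ^ N * (g * b * (3 * cy) ^ M), ?_⟩
  refine { good_of_ne_zero := ?_, rank_lt := ?_, rank_base := ?_, norm_le := ?_,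
           norm_diag_le := ?_, diag_base := ?_, nonneg := hε0, lt_one := hε }
  · intro k s p p' hp hne
    have := total_of_pairStep_ne_zero hne
    omega
  · intro k s p p' hne
    have h1 := rank_lt_of_columnMatrix_ne_zero (hconsx k) (left_ne_zero_of_mul hne)
    have h2 := rank_lt_of_columnMatrix_ne_zero (hconsy k)
      (right_ne_zero_of_mul (right_ne_zero_of_mul hne))
    rcases h1 with ⟨h1, hs⟩ | h1 <;> rcases h2 with ⟨h2, hs'⟩ | h2
    · exact .inl ⟨Prod.ext h1 h2, hs⟩
    · right; rw [h1]; omega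
    · right; rw [h2]; omega
    · right; omega
  · simp [rank]
  · intro k s p p'
    have h1 : ‖gauge q s‖ ≤ g :=
      single_le_sum (f := fun s => ‖gauge q s‖) (fun _ _ => norm_nonneg _) (mem_univ s)
    have h2 : ‖(q ^ 2) ^ total p'.2‖ ≤ b :=
      single_le_sum (f := fun B : Fin M → Fin 3 => ‖(q ^ 2) ^ total B‖)
        (fun _ _ => norm_nonneg _) (mem_univ p'.2)
    have h3 := norm_columnMatrix_le (fun i => hcx i k) p.1 p'.1 0 s
    have h4 := norm_columnMatrix_le (fun j => hcy j k) p.2 p'.2 0 s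
    rw [pairStep, norm_mul, norm_mul, norm_mul]
    have hg0 : 0 ≤ g := (norm_nonneg _).trans h1
    have hb0 : 0 ≤ b := (norm_nonneg _).trans h2
    have hx0 := (norm_nonneg _).trans h3
    gcongr
  · intro k p hgood hp
    -- the moduli of the diagonal weights of a single row, as functions of the state of that row
    set α : Fin N → Fin 3 → ℝ := fun i s => ‖W q (x i) (z k) 0 s 0 s‖ with hα
    set β : Fin M → Fin 3 → ℝ := fun j s =>
      ‖(q ^ 2) ^ (s : ℕ) * W q (y j) ((q ^ 3)⁻¹ * (z k)⁻¹) 0 s 0 s‖ with hβ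
    have hdiag : ‖pairStep q x y z k 0 p p‖ = (∏ i, α i (p.1 i)) * ∏ j, β j (p.2 j) := by
      rw [pairStep, columnMatrix_self (hconsx k), columnMatrix_self (hconsy k), norm_mul,
        norm_prod, show gauge q 0 = 1 from rfl, one_mul, total, ← prod_pow_eq_pow_sum,
        ← prod_mul_distrib, norm_prod]
    have hz0 := hz k
    have shift : ∀ j (n : ℕ), n ≤ 3 → y j - q ^ n * ((q ^ 3)⁻¹ * (z k)⁻¹) =
        -(1 - q ^ (3 - n) * y j * z k) * ((q ^ (3 - n))⁻¹ * (z k)⁻¹) := by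
      intro j n hn
      have h3 : q ^ 3 = q ^ n * q ^ (3 - n) := by rw [← pow_add, Nat.add_sub_cancel' hn]
      rw [h3]
      field_simp
      ring
    have β1 : ∀ j, β j 1 = ‖(1 - q ^ 3 * y j * z k) / (1 - q * y j * z k)‖ := by
      intro j
      have h1 := left_ne_zero_of_mul (hy j k)
      have h2 := right_ne_zero_of_mul (hy j k)
      have e0 := shift j 0 (by norm_num)
      have e2 := shift j 2 (by norm_num)
      simp only [pow_zero, one_mul, Nat.sub_zero, Nat.reduceSub, pow_one] at e0 e2
      change ‖(q ^ 2) ^ 1 *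
        ((y j - (q ^ 3)⁻¹ * (z k)⁻¹) / (y j - q ^ 2 * ((q ^ 3)⁻¹ * (z k)⁻¹)))‖ = _
      rw [e0, e2]
      congr 1
      field_simp
    have β2 : ∀ j, β j 2 = ‖((1 - q ^ 2 * y j * z k) * (1 - q ^ 3 * y j * z k)) /
            ((1 - y j * z k) * (1 - q * y j * z k))‖ := by
      intro j
      have h1 := left_ne_zero_of_mul (hy j k)
      have h2 := right_ne_zero_of_mul (hy j k)
      have e0 := shift j 0 (by norm_num)
      have e1 := shift j 1 (by norm_num)
      have e2 := shift j 2 (by norm_num)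
      have e3 := shift j 3 (by norm_num)
      simp only [pow_zero, one_mul, Nat.sub_zero, Nat.reduceSub, pow_one] at e0 e1 e2 e3
      change ‖(q ^ 2) ^ 2 * ((y j - (q ^ 3)⁻¹ * (z k)⁻¹) * (y j - q * ((q ^ 3)⁻¹ * (z k)⁻¹)) /
        ((y j - q ^ 2 * ((q ^ 3)⁻¹ * (z k)⁻¹)) * (y j - q ^ 3 * ((q ^ 3)⁻¹ * (z k)⁻¹))))‖ = _
      rw [e0, e1, e2, e3]
      congr 1
      field_simp
    have α1 : ∀ i, α i 1 = ‖(x i - z k) / (x i - q ^ 2 * z k)‖ := fun i => rfl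
    have α2 : ∀ i, α i 2 = ‖((x i - z k) * (x i - q * z k)) /
      ((x i - q ^ 2 * z k) * (x i - q ^ 3 * z k))‖ := fun i => rfl
    have hW0 : ∀ x y : ℂ, W q x y 0 0 0 0 = 1 := fun _ _ => rfl
    rw [hdiag]
    refine (prod_mul_prod_le (a := α) (b := β) hε.le (fun _ _ => norm_nonneg _)
      (fun _ _ => norm_nonneg _)
      (fun i => by simp [hα, hW0])
      (fun j => by simp [hβ, hW0]) ?_ ?_ ?_ ?_ p.1 p.2 hgood).trans
      (le_of_eq (if_neg fun h0 => hp ?_))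
    · intro i j
      rw [α1, β1, mul_comm, ← norm_mul]
      exact (h11 i j k).le
    · intro i j
      rw [α2, β2, mul_comm, ← norm_mul]
      exact (h22 i j k).le
    · intro i i' j hii
      rw [α1, α1, β2, mul_comm, ← mul_assoc, ← norm_mul, ← norm_mul]
      exact (h112 i i' j k hii).le
    · intro i j j' hjj
      rw [α2, β1, β1, mul_comm, ← norm_mul, ← norm_mul]
      exact (h211 i j j' k hjj).le
    · exact Prod.ext (eq_zero_of_total_eq_zero h0) (eq_zero_of_total_eq_zero (hgood ▸ h0))
  · intro k
    rw [pairStep, columnMatrix_self (hconsx k), columnMatrix_self (hconsy k)]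
    have hW0 : ∀ x y : ℂ, W q x y 0 0 0 0 = 1 := fun _ _ => rfl
    simp [hW0, gauge, total]

/-! ### The sum of the series -/

/-- At the pole `x * y = 1` of the Cauchy kernel, the diagonal factor of a pair of states `2` is
`1`. -/
theorem diag_two_eq_one {q x y z : ℂ} (hxy : x * y = 1)
    (hx : (x - q ^ 2 * z) * (x - q ^ 3 * z) ≠ 0) (hy : (1 - y * z) * (1 - q * y * z) ≠ 0) :
    ((1 - q ^ 2 * y * z) * (1 - q ^ 3 * y * z)) / ((1 - y * z) * (1 - q * y * z)) *
      (((x - z) * (x - q * z)) / ((x - q ^ 2 * z) * (x - q ^ 3 * z))) = 1 := by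
  have e : ∀ c : ℂ, x - c * z = x * (1 - c * y * z) := fun c => by
    linear_combination c * z * hxy
  have e1 := e 1
  rw [one_mul, one_mul] at e1
  rw [e, e] at hx
  rw [e1, e, e, e]
  have h1 := left_ne_zero_of_mul hy
  have h2 := right_ne_zero_of_mul hy
  have h3 := right_ne_zero_of_mul (left_ne_zero_of_mul hx)
  have h4 := right_ne_zero_of_mul (right_ne_zero_of_mul hx)
  have h5 := left_ne_zero_of_mul (left_ne_zero_of_mul hx)
  field_simp

/-- At the pole `q * x * y = 1` of the Cauchy kernel, the diagonal factor of a pair of states `1` is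
`1`. -/
theorem diag_one_eq_one {q x y z : ℂ} (hxy : q * x * y = 1) (hx : x - q ^ 2 * z ≠ 0)
    (hy : 1 - q * y * z ≠ 0) :
    (1 - q ^ 3 * y * z) / (1 - q * y * z) * ((x - z) / (x - q ^ 2 * z)) = 1 := by
  have e1 : x - z = x * (1 - q * y * z) := by linear_combination z * hxy
  have e2 : x - q ^ 2 * z = x * (1 - q ^ 3 * y * z) := by linear_combination q ^ 2 * z * hxy
  rw [e2] at hx
  rw [e1, e2]
  have h1 := left_ne_zero_of_mul hx
  have h2 := right_ne_zero_of_mul hx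
  field_simp

theorem vacuumValue_creation_two_zero (q : ℂ) (N M : ℕ) :
    vacuumValue (orderedProd (fun _ : Fin M => creation q) (fun _ => 2) *
      orderedProd (fun _ : Fin N => creation q) 0) = q⁻¹ ^ (4 * M * N) := by
  have h1 : inv (fun _ : Fin M => (2 : Fin 3)) = 0 := by simp [inv]
  have h2 : inv (0 : Fin N → Fin 3) = 0 := by simp [inv]
  have h3 : cototal (0 : Fin N → Fin 3) = 2 * N := by simp [cototal, mul_comm]
  have h4 : kappa q 2 = 1 := rfl
  have h5 : kappa q 0 = 1 := rfl
  rw [vacuumValue_creation, total_two, h1, h2, h3]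
  simp only [Pi.zero_apply, h4, h5, prod_const_one]
  ring

/-- For any number `L` of columns, the same linear combination of the partition functions with all
possible states on the right takes the same value. The `y` rows appear in reverse order, being
turned upside down. -/
theorem sum_fused_mul_sum_propagate {q : ℂ} (hq : q ≠ 0) (hq1 : q ≠ 1) {N M : ℕ} {x : Fin N → ℂ}
    {y : Fin M → ℂ} {z : ℕ → ℂ} (hz : ∀ k, z k ≠ 0)
    (hx : ∀ k i, (x i - q ^ 2 * z k) * (x i - q ^ 3 * z k) ≠ 0)
    (hy : ∀ k j, (1 - y j * z k) * (1 - q * y j * z k) ≠ 0) (L : ℕ) :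
    ∑ p : (Fin N → Fin 3) × (Fin M → Fin 3),
      fused (fun j i => polyW q 1 (x i * y j.rev)) (fun _ => 2) 0 p.1 (reflect p.2) *
        ∑ S ∈ stringsBelow L, propagate (pairStep q x y z) (pairInit q) S L p =
      (∏ j : Fin M, ∏ i, (1 - q ^ 2 * (x i * y j.rev)) * (1 - q ^ 3 * (x i * y j.rev))) *
        q⁻¹ ^ (4 * M * N) := by
  have h := prod_mul_eq_sum_fused_transfer
    (u := fun k i => W q (x i) (z k)) (v := fun k (j : Fin M) => dualW q (y j.rev) (z k))
    (fun k i => conserving_W _ _ _) (fun k j => conserving_dualW _ _ _) (fun _ _ => rfl)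
    (fun k j => dualW_two (hy k _)) (fun k j i => yangBaxter_W_dualW (hx k i) _)
    (fun j i => exchange_creation hq 1 (x i * y j.rev)) vacuumValue L
  rw [vacuumValue_creation_two_zero] at h
  rw [h, Fintype.sum_prod_type]
  refine sum_congr rfl fun A _ => Fintype.sum_equiv (reflectEquiv M) _ _ fun B => ?_
  change fused _ (fun _ => 2) 0 A (reflect B) * _ = fused _ (fun _ => 2) 0 A (reflect B) *
    transfer _ _ _ L A (reflect B)
  by_cases h0 : fused (fun j i => polyW q 1 (x i * y j.rev)) (fun _ => 2) 0 A (reflect B) = 0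
  · rw [h0, zero_mul, zero_mul]
  · have h1 := total_of_fused_ne_zero (fun j i => conserving_polyW _ _ _) h0
    rw [total_two] at h1
    have h2 := total_reflect B
    have h3 : total (0 : Fin N → Fin 3) = 0 := by simp [total]
    exact congrArg _ (transfer_eq_sum_propagate hq hq1 hz hy L A B (by omega)).symm


end

end IzerginKorepin

open IzerginKorepin in
theorem mainTheorem3 (N M : ℕ) (hN : 0 < N) (hM : 0 < M)
    (q : ℂ) (x : Fin N → ℂ) (y : Fin M → ℂ) (z : ℕ → ℂ)
    (hq : q ≠ 0) (hz : ∀ k, z k ≠ 0)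
    -- no pole of a vertex weight is hit or approached
    (δ : ℝ) (hδ : 0 < δ)
    (hx_pole : ∀ i k, δ * (‖x i‖ + ‖z k‖) ^ 2 ≤ ‖(x i - q ^ 2 * z k) * (x i - q ^ 3 * z k)‖)
    (hy_pole : ∀ j k, δ * (1 + ‖y j * z k‖) ^ 2 ≤ ‖(1 - y j * z k) * (1 - q * y j * z k)‖)
    -- the convergence conditions
    (ε : ℝ) (hε : ε < 1)
    (h11 : ∀ i j k,
      ‖(1 - q ^ 3 * y j * z k) / (1 - q * y j * z k) * ((x i - z k) / (x i - q ^ 2 * z k))‖ < ε)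
    (h22 : ∀ i j k,
      ‖((1 - q ^ 2 * y j * z k) * (1 - q ^ 3 * y j * z k)) /
            ((1 - y j * z k) * (1 - q * y j * z k)) *
          (((x i - z k) * (x i - q * z k)) / ((x i - q ^ 2 * z k) * (x i - q ^ 3 * z k)))‖ < ε)
    -- the same for a state 2 in one row against states 1 in two different rows
    (h112 : ∀ i i' j k, i ≠ i' →
      ‖((1 - q ^ 2 * y j * z k) * (1 - q ^ 3 * y j * z k)) /
            ((1 - y j * z k) * (1 - q * y j * z k)) *
          ((x i - z k) / (x i - q ^ 2 * z k)) * ((x i' - z k) / (x i' - q ^ 2 * z k))‖ < ε)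
    (h211 : ∀ i j j' k, j ≠ j' →
      ‖(1 - q ^ 3 * y j * z k) / (1 - q * y j * z k) *
          ((1 - q ^ 3 * y j' * z k) / (1 - q * y j' * z k)) *
          (((x i - z k) * (x i - q * z k)) / ((x i - q ^ 2 * z k) * (x i - q ^ 3 * z k)))‖ < ε) :
    HasSum
      (fun S : IzerginKorepin.NString 2 =>
        IzerginKorepin.halfSign S.weight *
          q ^ (4 * (M : ℤ) * (N : ℤ) - (S.weight : ℤ) ^ 2) *
          IzerginKorepin.cS q S *
          IzerginKorepin.H q x z S *
          IzerginKorepin.H q y (fun k => (q ^ 3)⁻¹ * (z k)⁻¹) S)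
      (∏ i : Fin N, ∏ j : Fin M,
        ((1 - q ^ 2 * x i * y j) * (1 - q ^ 3 * x i * y j)) /
          ((1 - x i * y j) * (1 - q * x i * y j))) := by
  have hx : ∀ k i, (x i - q ^ 2 * z k) * (x i - q ^ 3 * z k) ≠ 0 := by
    intro k i
    have h0 : 0 < ‖z k‖ := norm_pos_iff.2 (hz k)
    exact norm_pos_iff.1 (lt_of_lt_of_le (by positivity) (hx_pole i k))
  have hy : ∀ k j, (1 - y j * z k) * (1 - q * y j * z k) ≠ 0 := fun k j =>
    norm_pos_iff.1 (lt_of_lt_of_le (by positivity) (hy_pole j k))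
  have hε0 : 0 ≤ ε := (norm_nonneg _).trans (h11 ⟨0, hN⟩ ⟨0, hM⟩ 0).le
  -- for `q = 1` the diagonal factor of a pair of states `1` is `1`
  have hq1 : q ≠ 1 := by
    rintro rfl
    have h1 := left_ne_zero_of_mul (hx 0 ⟨0, hN⟩)
    have h2 := right_ne_zero_of_mul (hy 0 ⟨0, hM⟩)
    have h := h11 ⟨0, hN⟩ ⟨0, hM⟩ 0
    simp only [one_pow, one_mul] at h h1 h2
    rw [div_self h1, div_self h2, mul_one, norm_one] at h
    linarith
  -- at a pole of the right-hand side, a diagonal factor would be `1`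
  have hpole : ∀ i j, (1 - x i * y j) * (1 - q * x i * y j) ≠ 0 := by
    refine fun i j => mul_ne_zero (fun h0 => ?_) fun h0 => ?_
    · have h := h22 i j 0
      rw [diag_two_eq_one (sub_eq_zero.1 h0).symm (hx 0 i) (hy 0 j), norm_one] at h
      linarith
    · have h := h11 i j 0
      rw [diag_one_eq_one (sub_eq_zero.1 h0).symm (left_ne_zero_of_mul (hx 0 i))
        (right_ne_zero_of_mul (hy 0 j)), norm_one] at h
      linarith
  obtain ⟨C, hdec⟩ := isDecaying_pairStep hq hz hδ hx_pole hy_pole (fun j k => hy k j) hε0 hε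
    h11 h22 h112 h211
  have hu : ∀ p : (Fin N → Fin 3) × (Fin M → Fin 3), pairInit q p ≠ 0 → total p.1 = total p.2 :=
    fun p hp => by_contra fun hne => hp (if_neg hne)
  have hfused : fused (fun (j : Fin M) i => polyW q 1 (x i * y j.rev)) (fun _ => 2) 0 0
      (reflect 0) = ∏ j : Fin M, ∏ i, (1 - x i * y j.rev) * (1 - q * x i * y j.rev) := by
    rw [reflect_zero, fused_zero fun j i => conserving_polyW _ _ _]
    simp only [polyW_values, mul_assoc]
  have hsum := (hdec.hasSum hu (f := fun S =>
    propagate (pairStep q x y z) (pairInit q) S S.length (0, 0)) (fun S L hL => ?_)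
    (sum_fused_mul_sum_propagate hq hq1 hz hx hy) ?_).mul_left (q ^ (4 * M * N))
  · have hvalue : q ^ (4 * M * N) * ((∏ j : Fin M, ∏ i, (1 - q ^ 2 * (x i * y j.rev)) *
        (1 - q ^ 3 * (x i * y j.rev))) * q⁻¹ ^ (4 * M * N) /
          fused (fun (j : Fin M) i => polyW q 1 (x i * y j.rev)) (fun _ => 2) 0 0 (reflect 0)) =
        ∏ i : Fin N, ∏ j : Fin M, ((1 - q ^ 2 * x i * y j) * (1 - q ^ 3 * x i * y j)) /
          ((1 - x i * y j) * (1 - q * x i * y j)) := by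
      rw [hfused, inv_pow, mul_div_assoc', mul_left_comm, mul_inv_cancel₀ (pow_ne_zero _ hq),
        mul_one, ← Finset.prod_div_distrib]
      refine (Eq.trans ?_ (Equiv.prod_comp Fin.revPerm _)).trans Finset.prod_comm
      refine Finset.prod_congr rfl fun j _ => ?_
      rw [← Finset.prod_div_distrib]
      refine Finset.prod_congr rfl fun i _ => ?_
      simp only [Fin.revPerm_apply, mul_assoc]
    rw [← hvalue, funext fun S => halfSign_mul_cS_mul_H_mul_H hq x y z (le_refl S.length)]
    exact hsum
  · -- the value of `propagate` does not depend on the number of columns, as both are the summand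
    refine mul_left_cancel₀ (pow_ne_zero (4 * M * N) hq) ?_
    rw [← halfSign_mul_cS_mul_H_mul_H hq x y z le_rfl, ← halfSign_mul_cS_mul_H_mul_H hq x y z hL]
  · rw [hfused]
    exact Finset.prod_ne_zero_iff.2 fun j _ => Finset.prod_ne_zero_iff.2 fun i _ => hpole i _
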